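/- Let $I=[0,1]$, let $H_+$ be the group of increasing self-homeomorphisms of $I$ under composition, and let $H_+^{AC}$ be the subgroup of those $f\in H_+$ for which both $f$ and $f^{-1}$ are absolutely continuous, with the topology of the metric $\rho(f,g)=\int_0^1|f'-g'|\,d\lambda$, where $\lambda$ is Lebesgue measure. For $f\in H_+$ put $\mathrm{Fix}(f)=\{x\in I: f(x)=x\}$. The orbitals of $f$ of nonzero parity are the connected components of $I\setminus\mathrm{Fix}(f)$, with their natural left-to-right order; the orbital containing $x$ has positive parity if $f(x)>x$ and negative parity if $f(x)<x$. Let $C\subseteq H_+$ be the set of $f$ whose orbitals of nonzero parity form a (nonempty) dense linear order without endpoints in which the orbitals of positive parity and the orbitals of negative parity are each dense, and let $N\subseteq H_+$ be the set of $f$ such that $\mathrm{Fix}(f)$ is Lebesgue-null. An element of $H_+^{AC}$ is called generic if its conjugacy class in $H_+^{AC}$ is comeagre. Theorem. $H_+^{AC}$ has a generic element. An element $f\in H_+^{AC}$ is generic if and only if it has the following three properties: (i) $\mathrm{Fix}(f)$ is totally disconnected and has no isolated points (that is, it is a Cantor set); (ii) for any connected components $(a,b)$ and $(c,d)$ of $I\setminus\mathrm{Fix}(f)$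 with $b<c$, there are points $x,y\in(b,c)$ with $f(x)<x$ and $f(y)>y$; (iii) $\mathrm{Fix}(f)$ has Lebesgue measure zero. Moreover, the set of generic elements is $C\cap N\cap H_+^{AC}$; this set is a single conjugacy class of $H_+^{AC}$, and it is a dense $G_\delta$ subset of $H_+^{AC}$. -/

import Mathlib

open Set Filter Topology MeasureTheory

/-- `H₊`: the group of increasing self-homeomorphisms of `I = [0,1]`.  Since the topology of `I` is
its order topology, these are exactly the order isomorphisms of `I`.  Multiplication is
composition. -/
abbrev Hplus : Type := unitInterval ≃o unitInterval

namespace Hplus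

/-- `f ∈ H₊` as a function `ℝ → ℝ`, extended by constants (`0` and `1`) outside `[0,1]`. -/
noncomputable def ext (f : Hplus) : ℝ → ℝ :=
  Set.IccExtend (zero_le_one (α := ℝ)) (fun x : unitInterval => (f x : ℝ))

/-- `f` is absolutely continuous on `[0,1]`. -/
def IsAC (f : Hplus) : Prop := AbsolutelyContinuousOnInterval f.ext 0 1

theorem ext_coe (f : Hplus) (x : unitInterval) : f.ext x = f x :=
  Set.IccExtend_val _ _ x

theorem ext_of_mem (f : Hplus) {x : ℝ} (hx : x ∈ Icc (0 : ℝ) 1) : f.ext x = f ⟨x, hx⟩ :=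
  ext_coe f ⟨x, hx⟩

theorem ext_monotone (f : Hplus) : Monotone f.ext :=
  Monotone.IccExtend _ (fun _ _ h => f.monotone h)

theorem ext_mem (f : Hplus) (x : ℝ) : f.ext x ∈ Icc (0 : ℝ) 1 := by
  unfold ext Set.IccExtend
  exact (f _).2

theorem isAC_one : IsAC 1 := by
  have h : LipschitzOnWith 1 (ext 1) (uIcc (0 : ℝ) 1) := by
    intro x hx y hy
    rw [uIcc_of_le zero_le_one] at hx hy
    rw [ext_of_mem _ hx, ext_of_mem _ hy]
    simp
  exact h.absolutelyContinuousOnInterval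

theorem IsAC.mul {f g : Hplus} (hf : f.IsAC) (hg : g.IsAC) : (f * g).IsAC := by
  have key : ∀ x ∈ Icc (0 : ℝ) 1, (f * g).ext x = f.ext (g.ext x) := by
    intro x hx
    rw [ext_of_mem _ hx, ext_of_mem g hx, ext_coe]
    rfl
  unfold IsAC at *
  rw [absolutelyContinuousOnInterval_iff] at *
  intro ε hε
  obtain ⟨δ, hδ, h1⟩ := hf ε hε
  obtain ⟨η, hη, h2⟩ := hg δ hδ
  refine ⟨η, hη, fun E hE hs => ?_⟩
  have h3 := h1 (E.1, fun i => (g.ext (E.2 i).1, g.ext (E.2 i).2)) ?_ (h2 E hE hs)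
  · refine lt_of_le_of_lt (le_of_eq (Finset.sum_congr rfl fun i hi => ?_)) h3
    have := hE.1 i hi
    rw [uIcc_of_le zero_le_one] at this
    rw [key _ this.1, key _ this.2]
  · refine ⟨fun i _ => ?_, fun i hi j hj hij => ?_⟩
    · rw [uIcc_of_le zero_le_one]
      exact ⟨ext_mem g _, ext_mem g _⟩
    · have h := hE.2 hi hj hij
      simp only [Function.onFun, uIoc, Ioc_disjoint_Ioc, ← g.ext_monotone.map_max,
        ← g.ext_monotone.map_min] at h ⊢
      exact g.ext_monotone h

/-- The fixed point set of `f`. -/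
def Fix (f : Hplus) : Set unitInterval := {x | f x = x}

open Classical in
/-- The orbital of `x` under `f`: `{x}` if `x` is fixed, and otherwise the connected component of
`I \ Fix f` that contains `x`. -/
noncomputable def orbital (f : Hplus) (x : unitInterval) : Set unitInterval :=
  if x ∈ f.Fix then {x} else connectedComponentIn (f.Fix)ᶜ x

/-- The orbitals of nonzero parity, i.e. the connected components of `I \ Fix f`. -/
def nonzeroOrbitals (f : Hplus) : Set (Set unitInterval) :=
  {J | ∃ x, x ∉ f.Fix ∧ J = f.orbital x}

/-- The orbitals of positive parity. -/
def positiveOrbitals (f : Hplus) : Set (Set unitInterval) :=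
  {J | ∃ x, x < f x ∧ J = f.orbital x}

/-- The orbitals of negative parity. -/
def negativeOrbitals (f : Hplus) : Set (Set unitInterval) :=
  {J | ∃ x, f x < x ∧ J = f.orbital x}

/-- The natural strict order between orbitals: `J` lies entirely to the left of `K`. -/
def Precedes (J K : Set unitInterval) : Prop := ∀ x ∈ J, ∀ y ∈ K, x < y

/-- The set `C` of all `f ∈ H₊` for which the orbitals of nonzero parity form a (nonempty) dense
linear order without endpoints, in which both the orbitals of positive parity and the orbitals
of negative parity are dense. -/
def setC : Set Hplus :=
  {f | f.nonzeroOrbitals.Nonempty ∧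
    IsStrictTotalOrder f.nonzeroOrbitals (fun J K => Precedes J.1 K.1) ∧
    (∀ J ∈ f.nonzeroOrbitals, ∀ K ∈ f.nonzeroOrbitals, Precedes J K →
      ∃ L ∈ f.nonzeroOrbitals, Precedes J L ∧ Precedes L K) ∧
    (∀ J ∈ f.nonzeroOrbitals, ∃ L ∈ f.nonzeroOrbitals, Precedes L J) ∧
    (∀ J ∈ f.nonzeroOrbitals, ∃ L ∈ f.nonzeroOrbitals, Precedes J L) ∧
    (∀ J ∈ f.nonzeroOrbitals, ∀ K ∈ f.nonzeroOrbitals, Precedes J K →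
      ∃ L ∈ f.positiveOrbitals, Precedes J L ∧ Precedes L K) ∧
    (∀ J ∈ f.nonzeroOrbitals, ∀ K ∈ f.nonzeroOrbitals, Precedes J K →
      ∃ L ∈ f.negativeOrbitals, Precedes J L ∧ Precedes L K)}

/-- The set `N` of all `f ∈ H₊` whose fixed point set is Lebesgue-null. -/
def setN : Set Hplus :=
  {f | volume ((fun x : unitInterval => (x : ℝ)) '' f.Fix) = 0}

end Hplus

/-- `H₊^{AC}`: the subgroup of those `f ∈ H₊` such that both `f` and `f⁻¹` are absolutely
continuous. -/
def HplusAC : Subgroup Hplus where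
  carrier := {f | f.IsAC ∧ (f⁻¹).IsAC}
  mul_mem' {f g} hf hg := ⟨hf.1.mul hg.1, by rw [mul_inv_rev]; exact hg.2.mul hf.2⟩
  one_mem' := ⟨Hplus.isAC_one, by rw [inv_one]; exact Hplus.isAC_one⟩
  inv_mem' {f} hf := ⟨hf.2, by rw [inv_inv]; exact hf.1⟩

namespace HplusAC

/-- The metric `ρ(f,g) = ∫₀¹ |f' - g'| dλ` on `H₊^{AC}`; it is the source of the topology of
`H₊^{AC}`. -/
noncomputable def rho (f g : HplusAC) : ℝ :=
  ∫ x in (0 : ℝ)..1, |deriv f.1.ext x - deriv g.1.ext x|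

theorem intervalIntegrable_sub (f g : HplusAC) :
    IntervalIntegrable (fun x => deriv f.1.ext x - deriv g.1.ext x) volume 0 1 :=
  (AbsolutelyContinuousOnInterval.intervalIntegrable_deriv f.2.1).sub
    (AbsolutelyContinuousOnInterval.intervalIntegrable_deriv g.2.1)

theorem eq_of_rho_eq_zero (f g : HplusAC) (h : rho f g = 0) : f = g := by
  have hint := intervalIntegrable_sub f g
  apply Subtype.ext
  apply OrderIso.ext
  funext t
  apply Subtype.ext
  have h0 : ∀ k : Hplus, k.ext 0 = 0 := by
    intro k
    have h1 := k.ext_coe 0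
    have h2 : k 0 = 0 := k.map_bot
    rw [h2] at h1
    simpa using h1
  have hF : ∀ k : HplusAC, ∫ x in (0 : ℝ)..t, deriv k.1.ext x = k.1 t := by
    intro k
    have hk : AbsolutelyContinuousOnInterval k.1.ext 0 t := by
      refine AbsolutelyContinuousOnInterval.mono k.2.1 ?_
      rw [uIcc_of_le t.2.1, uIcc_of_le zero_le_one]
      exact Icc_subset_Icc_right t.2.2
    rw [hk.integral_deriv_eq_sub, h0, Hplus.ext_coe, sub_zero]
  have hsub : uIcc (0 : ℝ) t ⊆ uIcc 0 1 := by
    rw [uIcc_of_le t.2.1, uIcc_of_le zero_le_one]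
    exact Icc_subset_Icc_right t.2.2
  have hle : |∫ x in (0 : ℝ)..t, (deriv f.1.ext x - deriv g.1.ext x)| ≤ rho f g := by
    refine (intervalIntegral.abs_integral_le_integral_abs t.2.1).trans ?_
    exact intervalIntegral.integral_mono_interval le_rfl t.2.1 t.2.2
      (Eventually.of_forall fun x => abs_nonneg _) hint.abs
  rw [h, intervalIntegral.integral_sub
    ((AbsolutelyContinuousOnInterval.intervalIntegrable_deriv f.2.1).mono_set hsub)
    ((AbsolutelyContinuousOnInterval.intervalIntegrable_deriv g.2.1).mono_set hsub),
    hF, hF] at hle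
  exact sub_eq_zero.mp (abs_nonpos_iff.mp hle)

/-- `H₊^{AC}` carries the metric `ρ` and the topology generated by it. -/
noncomputable instance : MetricSpace HplusAC where
  dist := rho
  dist_self f := by simp [rho]
  dist_comm f g := by simp only [rho, abs_sub_comm]
  dist_triangle f g h := by
    unfold rho
    rw [← intervalIntegral.integral_add (intervalIntegrable_sub f g).abs
      (intervalIntegrable_sub g h).abs]
    exact intervalIntegral.integral_mono_on zero_le_one (intervalIntegrable_sub f h).abs
      ((intervalIntegrable_sub f g).abs.add (intervalIntegrable_sub g h).abs)
      (fun x _ => abs_sub_le _ _ _)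
  eq_of_dist_eq_zero := eq_of_rho_eq_zero _ _

/-- `C ∩ N ∩ H₊^{AC}`, as a subset of `H₊^{AC}`. -/
def setCN : Set HplusAC := {f | (f : Hplus) ∈ Hplus.setC ∩ Hplus.setN}

end HplusAC

/-- An element of a topological group is generic if its conjugacy class is comeagre. -/
def IsGenericElement {G : Type*} [Group G] [TopologicalSpace G] (g : G) : Prop :=
  conjugatesOf g ∈ residual G

/-!
The derivative embeds `H₊^{AC}` isometrically into `L¹(I)`, with image the almost everywhere
positive densities of integral `1`. These form a `Gδ` set, so `H₊^{AC}` is completely metrizable and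
Baire.

A homeomorphism with null fixed point set lies in `C` if and only if it is alternating: `f - id`
changes sign twice near every fixed point. Being alternating and having a null fixed point set are
both dense `Gδ` conditions: a piecewise linear perturbation near a fixed point creates the sign
changes, and the convex combinations of `f` with a map above the identity have disjoint sets of
interior fixed points, so that most of these are null. Hence `C ∩ N` is comeagre in `H₊^{AC}`.

Two elements of `C ∩ N` are conjugate. By a back-and-forth argument there is a parity-preserving
isomorphism between their orders of orbitals, and on each orbital either map is conjugate to the
translation of `ℝ` by `1` or `-1`, by a chart that preserves null sets in both directions. Gluing
the charts gives a conjugating homeomorphism, which again preserves null sets in both directions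
because the fixed point sets are null, and is therefore bi-absolutely continuous. Finally, two
comeagre conjugacy classes of a Baire group meet, hence coincide.
-/

/-! ### Absolute continuity and densities -/

section IndefiniteIntegral

theorem setIntegral_Iic_add_setIntegral_Ioc {α : Type*} [LinearOrder α] [TopologicalSpace α]
    [OrderClosedTopology α] [MeasurableSpace α] [OpensMeasurableSpace α] {μ : Measure α}
    {r : α → ℝ} (hr : Integrable r μ) {a b : α} (hab : a ≤ b) :
    ∫ x in Iic a, r x ∂μ + ∫ x in Ioc a b, r x ∂μ = ∫ x in Iic b, r x ∂μ := by
  rw [← Iic_union_Ioc_eq_Iic hab, setIntegral_union (Iic_disjoint_Ioc le_rfl) measurableSet_Ioc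
    hr.integrableOn hr.integrableOn]

theorem strictMono_setIntegral_Iic {α : Type*} [LinearOrder α] [DenselyOrdered α]
    [TopologicalSpace α] [OrderClosedTopology α] [MeasurableSpace α] [OpensMeasurableSpace α]
    {μ : Measure α} [μ.IsOpenPosMeasure] {r : α → ℝ} (hr : Integrable r μ)
    (hpos : ∀ᵐ x ∂μ, 0 < r x) : StrictMono fun a => ∫ x in Iic a, r x ∂μ := by
  intro a b hab
  have hIoc : 0 < μ (Ioc a b) :=
    (isOpen_Ioo.measure_pos μ (nonempty_Ioo.2 hab)).trans_le (measure_mono Ioo_subset_Ioc_self)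
  have hsupport : (Function.support r ∩ Ioc a b : Set α) =ᵐ[μ] Ioc a b := by
    filter_upwards [hpos] with x hx
    exact propext (and_iff_right hx.ne')
  have : 0 < ∫ x in Ioc a b, r x ∂μ := by
    rwa [setIntegral_pos_iff_support_of_nonneg_ae
      (ae_restrict_of_ae (hpos.mono fun _ hx => hx.le)) hr.integrableOn, measure_congr hsupport]
  linarith [setIntegral_Iic_add_setIntegral_Ioc hr hab.le]

theorem integrable_coe_iff_intervalIntegrable {g : ℝ → ℝ} :
    Integrable (fun x : unitInterval => g x) ↔ IntervalIntegrable g volume 0 1 := by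
  rw [intervalIntegrable_iff_integrableOn_Icc_of_le zero_le_one]
  exact unitInterval.measurePreserving_coe.integrable_comp_emb
    unitInterval.measurableEmbedding_coe

theorem setIntegral_Iic_coe (g : ℝ → ℝ) (x : unitInterval) :
    ∫ y in Iic x, g y = ∫ y in (0 : ℝ)..x, g y := by
  have hIcc : Iic (x : ℝ) ∩ Icc 0 1 = Icc 0 (x : ℝ) := by
    ext y
    exact ⟨fun h => ⟨h.2.1, h.1⟩, fun h => ⟨h.2, h.1, h.2.trans x.2.2⟩⟩
  rw [intervalIntegral.integral_of_le x.2.1, ← integral_Icc_eq_integral_Ioc, ← hIcc,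
    ← Measure.restrict_restrict measurableSet_Iic]
  exact unitInterval.measurePreserving_coe.setIntegral_preimage_emb
    unitInterval.measurableEmbedding_coe g (Iic (x : ℝ))

theorem setIntegral_Iic_one {μ : Measure unitInterval} (r : unitInterval → ℝ) :
    ∫ y in Iic 1, r y ∂μ = ∫ y, r y ∂μ := by
  rw [show Iic (1 : unitInterval) = univ from Iic_top, setIntegral_univ]

theorem integral_coe (g : ℝ → ℝ) : ∫ y : unitInterval, g y = ∫ y in (0 : ℝ)..1, g y := by
  rw [← setIntegral_Iic_one, setIntegral_Iic_coe, Icc.coe_one]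

instance : (volume : Measure unitInterval).IsOpenPosMeasure where
  open_pos U hU hne := by
    obtain ⟨a, b, hab, hIoo⟩ := hU.exists_Ioo_subset hne
    refine ((unitInterval.volume_Ioo a b ▸ ENNReal.ofReal_pos.2 ?_).trans_le
      (measure_mono hIoo)).ne'
    exact sub_pos.2 hab

theorem exists_absolutelyContinuous_eq_setIntegral_Iic {r : unitInterval → ℝ}
    (hr : Integrable r) :
    ∃ F : ℝ → ℝ, AbsolutelyContinuousOnInterval F 0 1 ∧
      ∀ x : unitInterval, F x = ∫ y in Iic x, r y := by
  have hext (y : unitInterval) : IccExtend (zero_le_one (α := ℝ)) r y = r y := IccExtend_val _ _ y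
  refine ⟨fun x => ∫ y in (0 : ℝ)..x, IccExtend (zero_le_one (α := ℝ)) r y,
    IntervalIntegrable.absolutelyContinuousOnInterval_intervalIntegral (c := 0) ?_ left_mem_uIcc,
    fun x => ?_⟩
  · simpa only [← integrable_coe_iff_intervalIntegrable, hext] using hr
  · simp only [← setIntegral_Iic_coe, hext]

theorem continuous_setIntegral_Iic {r : unitInterval → ℝ} (hr : Integrable r) :
    Continuous fun x => ∫ y in Iic x, r y := by
  obtain ⟨F, hF, hFr⟩ := exists_absolutelyContinuous_eq_setIntegral_Iic hr
  simp only [← hFr]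
  refine hF.continuousOn.comp_continuous continuous_subtype_val fun x => ?_
  rw [uIcc_of_le zero_le_one]
  exact x.2

end IndefiniteIntegral

namespace Hplus

theorem map_zero (f : Hplus) : f 0 = 0 := f.map_bot

theorem map_one (f : Hplus) : f 1 = 1 := f.map_top

theorem comap_volume_apply (f : Hplus) (s : Set unitInterval) :
    volume.comap f s = volume (f '' s) :=
  f.toHomeomorph.measurableEmbedding.comap_apply volume s

/-- `f x = ∫₀ˣ r` for all `x`, with `r` integrable and nonnegative. -/
structure HasDensity (f : Hplus) (r : unitInterval → ℝ) : Prop where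
  integrable : Integrable r
  nonneg : 0 ≤ᵐ[volume] r
  apply_eq : ∀ x, (f x : ℝ) = ∫ y in Iic x, r y

namespace HasDensity

variable {f : Hplus} {r r' : unitInterval → ℝ}

theorem integral_eq_one (h : f.HasDensity r) : ∫ x, r x = 1 := by
  rw [← setIntegral_Iic_one, ← h.apply_eq, f.map_one, Icc.coe_one]

theorem setIntegral_Ioc (h : f.HasDensity r) {a b : unitInterval} (hab : a ≤ b) :
    ∫ x in Ioc a b, r x = f b - f a := by
  rw [h.apply_eq, h.apply_eq, ← setIntegral_Iic_add_setIntegral_Ioc h.integrable hab,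
    add_sub_cancel_left]

theorem comap_volume (h : f.HasDensity r) :
    volume.comap f = volume.withDensity fun x => ENNReal.ofReal (r x) := by
  refine Measure.ext_of_Iic _ _ fun x => ?_
  rw [comap_volume_apply, OrderIso.image_Iic, unitInterval.volume_Iic, h.apply_eq,
    withDensity_apply _ measurableSet_Iic, ofReal_integral_eq_lintegral_ofReal
      h.integrable.integrableOn (ae_restrict_of_ae h.nonneg)]

theorem volume_image_eq_zero (h : f.HasDensity r) {s : Set unitInterval} (hs : volume s = 0) :
    volume (f '' s) = 0 := by
  rw [← comap_volume_apply, h.comap_volume]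
  exact withDensity_absolutelyContinuous _ _ hs

theorem volume_symm_image_eq_zero (h : f.HasDensity r) (hpos : ∀ᵐ x, 0 < r x)
    {s : Set unitInterval} (hs : volume s = 0) : volume (f.symm '' s) = 0 := by
  have hac : volume ≪ volume.comap f := h.comap_volume ▸
    withDensity_absolutelyContinuous' h.integrable.aemeasurable.ennreal_ofReal
      (hpos.mono fun x hx => (ENNReal.ofReal_pos.2 hx).ne')
  apply hac
  rwa [comap_volume_apply, OrderIso.image_symm_image]

theorem isAC (h : f.HasDensity r) : f.IsAC := by
  obtain ⟨F, hF, hFr⟩ := exists_absolutelyContinuous_eq_setIntegral_Iic h.integrable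
  have hext {x : ℝ} (hx : x ∈ uIcc (0 : ℝ) 1) : f.ext x = F x := by
    rw [uIcc_of_le zero_le_one] at hx
    rw [ext_of_mem _ hx, h.apply_eq, ← hFr]
  unfold IsAC
  rw [absolutelyContinuousOnInterval_iff] at hF ⊢
  intro ε hε
  obtain ⟨δ, hδ, hFδ⟩ := hF ε hε
  refine ⟨δ, hδ, fun E hE hlen => (hFδ E hE hlen).trans_eq' ?_⟩
  exact Finset.sum_congr rfl fun i hi => by rw [hext (hE.1 i hi).1, hext (hE.1 i hi).2]

theorem ae_unique (h : f.HasDensity r) (h' : f.HasDensity r') : r =ᵐ[volume] r' := by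
  have hfin : ∫⁻ x, ENNReal.ofReal (r x) ≠ ⊤ := by
    rw [← ofReal_integral_eq_lintegral_ofReal h.integrable h.nonneg]
    exact ENNReal.ofReal_ne_top
  have hofReal := (withDensity_eq_iff h.integrable.aemeasurable.ennreal_ofReal
    h'.integrable.aemeasurable.ennreal_ofReal hfin).1 (h.comap_volume.symm.trans h'.comap_volume)
  filter_upwards [hofReal, h.nonneg, h'.nonneg] with x hx hrx hr'x
  exact (ENNReal.ofReal_eq_ofReal_iff hrx hr'x).1 hx

end HasDensity

theorem exists_hasDensity {r : unitInterval → ℝ} (hr : Integrable r) (hpos : ∀ᵐ x, 0 < r x)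
    (hint : ∫ x, r x = 1) : ∃ f : Hplus, f.HasDensity r := by
  have hmono := strictMono_setIntegral_Iic hr hpos
  have hzero : ∫ y in Iic (0 : unitInterval), r y = 0 := by
    rw [show Iic (0 : unitInterval) = {0} from Iic_bot,
      Measure.restrict_zero_set (measure_singleton 0), integral_zero_measure]
  have hone : ∫ y in Iic (1 : unitInterval), r y = 1 := by rw [setIntegral_Iic_one, hint]
  let F (x : unitInterval) : unitInterval :=
    ⟨∫ y in Iic x, r y, hzero.symm.trans_le (hmono.monotone x.2.1),
      (hmono.monotone x.2.2).trans_eq hone⟩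
  have hF : StrictMono F := fun x y hxy => hmono hxy
  have hsurj : Function.Surjective F := fun y =>
    mem_range_of_exists_le_of_exists_ge ((continuous_setIntegral_Iic hr).subtype_mk _)
      ⟨0, hzero.trans_le y.2.1⟩ ⟨1, y.2.2.trans_eq hone.symm⟩
  exact ⟨hF.orderIsoOfSurjective F hsurj, hr, hpos.mono fun _ hx => hx.le, fun _ => rfl⟩

/-- The derivative of `f`, as a function on `[0,1]`. -/
noncomputable def density (f : Hplus) (x : unitInterval) : ℝ := deriv f.ext x

theorem IsAC.hasDensity {f : Hplus} (hf : f.IsAC) : f.HasDensity f.density where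
  integrable := integrable_coe_iff_intervalIntegrable.2 hf.intervalIntegrable_deriv
  nonneg := ae_of_all _ fun _ => f.ext_monotone.deriv_nonneg
  apply_eq x := by
    have hfx : AbsolutelyContinuousOnInterval f.ext 0 x := by
      refine AbsolutelyContinuousOnInterval.mono hf ?_
      rw [uIcc_of_le x.2.1, uIcc_of_le zero_le_one]
      exact Icc_subset_Icc_right x.2.2
    have hzero : f.ext 0 = 0 := by
      rw [ext_of_mem f unitInterval.zero_mem]
      exact congrArg Subtype.val f.map_zero
    unfold density
    rw [setIntegral_Iic_coe (deriv f.ext), hfx.integral_deriv_eq_sub, ext_coe, hzero, sub_zero]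

theorem isAC_of_volume_image_eq_zero {f : Hplus}
    (hf : ∀ s : Set unitInterval, volume s = 0 → volume (f '' s) = 0) : f.IsAC := by
  have hac : volume.comap f ≪ volume := fun s hs => by rw [comap_volume_apply, hf s hs]
  refine HasDensity.isAC (r := fun x => ((volume.comap f).rnDeriv volume x).toReal)
    ⟨Measure.integrable_toReal_rnDeriv, ae_of_all _ fun _ => ENNReal.toReal_nonneg, fun x => ?_⟩
  rw [Measure.setIntegral_toReal_rnDeriv hac, Measure.real, comap_volume_apply,
    OrderIso.image_Iic, unitInterval.volume_Iic, ENNReal.toReal_ofReal (f x).2.1]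

theorem mem_HplusAC_iff {f : Hplus} : f ∈ HplusAC ↔
    (∀ s : Set unitInterval, volume s = 0 → volume (f '' s) = 0) ∧
    (∀ s : Set unitInterval, volume s = 0 → volume (f.symm '' s) = 0) :=
  ⟨fun h => ⟨fun _ => h.1.hasDensity.volume_image_eq_zero,
      fun _ => h.2.hasDensity.volume_image_eq_zero⟩,
    fun h => ⟨isAC_of_volume_image_eq_zero h.1, isAC_of_volume_image_eq_zero h.2⟩⟩

theorem HasDensity.mem_HplusAC {f : Hplus} {r : unitInterval → ℝ} (h : f.HasDensity r)
    (hpos : ∀ᵐ x, 0 < r x) : f ∈ HplusAC :=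
  mem_HplusAC_iff.2 ⟨fun _ => h.volume_image_eq_zero, fun _ => h.volume_symm_image_eq_zero hpos⟩

end Hplus

namespace HplusAC

theorem hasDensity (f : HplusAC) : f.1.HasDensity f.1.density := f.2.1.hasDensity

theorem density_pos_ae (f : HplusAC) : ∀ᵐ x, 0 < f.1.density x := by
  have hnull : volume.comap f.1 {x | ¬ 0 < f.1.density x} = 0 := by
    rw [(hasDensity f).comap_volume, withDensity_apply_eq_zero'
      (hasDensity f).integrable.aemeasurable.ennreal_ofReal]
    convert measure_empty (μ := (volume : Measure unitInterval)) using 2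
    ext x
    simp
  rw [ae_iff, ← f.1.symm_image_image {x | ¬ 0 < f.1.density x}]
  exact (Hplus.mem_HplusAC_iff.1 f.2).2 _ (Hplus.comap_volume_apply _ _ ▸ hnull)

theorem exists_hasDensity {r : unitInterval → ℝ} (hr : Integrable r) (hpos : ∀ᵐ x, 0 < r x)
    (hint : ∫ x, r x = 1) : ∃ f : HplusAC, f.1.HasDensity r := by
  obtain ⟨f, hf⟩ := Hplus.exists_hasDensity hr hpos hint
  exact ⟨⟨f, hf.mem_HplusAC hpos⟩, hf⟩

end HplusAC

namespace HplusAC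

theorem dist_eq (f g : HplusAC) : dist f g = ∫ x, |f.1.density x - g.1.density x| :=
  (integral_coe fun x => |deriv f.1.ext x - deriv g.1.ext x|).symm

theorem abs_apply_sub_le_dist (f g : HplusAC) (x : unitInterval) :
    |(f.1 x : ℝ) - g.1 x| ≤ dist f g := by
  have hf := hasDensity f
  have hg := hasDensity g
  rw [hf.apply_eq, hg.apply_eq, dist_eq,
    ← integral_sub hf.integrable.integrableOn hg.integrable.integrableOn]
  exact abs_integral_le_integral_abs.trans (setIntegral_le_integral
    (hf.integrable.sub hg.integrable).abs (ae_of_all _ fun _ => abs_nonneg _))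

theorem continuous_eval : Continuous fun p : HplusAC × unitInterval => p.1.1 p.2 := by
  refine continuous_iff_continuousAt.2 fun ⟨f, x⟩ => tendsto_iff_dist_tendsto_zero.2 ?_
  have hbound : Tendsto (fun p : HplusAC × unitInterval => dist p.1 f + dist (f.1 p.2) (f.1 x))
      (𝓝 (f, x)) (𝓝 0) := by
    have hcont : Continuous fun p : HplusAC × unitInterval =>
        dist p.1 f + dist (f.1 p.2) (f.1 x) :=
      (continuous_fst.dist continuous_const).add
        ((f.1.continuous.comp continuous_snd).dist continuous_const)
    simpa only [dist_self, add_zero] using hcont.tendsto (f, x)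
  refine squeeze_zero (fun _ => dist_nonneg) (fun p => (dist_triangle _ (f.1 p.2) _).trans ?_)
    hbound
  exact add_le_add_left (abs_apply_sub_le_dist p.1 f p.2) _

end HplusAC

/-! ### Complete metrizability -/

theorem baireSpace_of_isGδ {X : Type*} [MetricSpace X] [CompleteSpace X] {s : Set X}
    (hs : IsGδ s) : BaireSpace s := by
  have : CompleteSpace (closure s) := isClosed_closure.completeSpace_coe
  have hdense : Dense ((↑) ⁻¹' s : Set (closure s)) := by
    rw [Subtype.dense_iff, Subtype.image_preimage_coe, inter_eq_right.2 subset_closure]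
  have := (hs.preimage continuous_subtype_val).baireSpace_of_dense hdense
  have hrange : range (inclusion (subset_closure (s := s))) = (↑) ⁻¹' s := range_inclusion _
  exact ((Topology.IsEmbedding.inclusion subset_closure).toHomeomorph.trans
    (.setCongr hrange)).symm.baireSpace

section PositiveL1

variable {α : Type*} [MeasurableSpace α] {μ : Measure α}

theorem continuous_integral_min_one_mul (m : ℕ) :
    Continuous fun r : α →₁[μ] ℝ => ∫ x, min 1 (m * r x) ∂μ := by
  have hlip : LipschitzWith m fun t : ℝ => min 1 (m * t) :=
    (LipschitzWith.of_dist_le_mul fun s t => by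
      rw [Real.dist_eq, ← mul_sub, abs_mul, Nat.abs_cast, Real.dist_eq]; rfl).const_min 1
  have hzero : min 1 ((m : ℝ) * 0) = 0 := by simp
  refine (continuous_integral.comp (hlip.continuous_compLp hzero)).congr fun r => ?_
  exact integral_congr_ae (hlip.coeFn_compLp hzero r)

variable [IsFiniteMeasure μ] {r : α → ℝ}

theorem integrable_min_one_mul (hr : Integrable r μ) (m : ℕ) :
    Integrable (fun x => min 1 (m * r x)) μ :=
  (integrable_const (1 : ℝ)).inf (hr.const_mul (m : ℝ))

theorem tendsto_integral_min_one_mul (hr : Integrable r μ) (hpos : ∀ᵐ x ∂μ, 0 < r x) :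
    Tendsto (fun m : ℕ => ∫ x, min 1 (m * r x) ∂μ) atTop (𝓝 (μ.real univ)) := by
  have hone : ∫ _ : α, (1 : ℝ) ∂μ = μ.real univ := by simp
  rw [← hone]
  refine tendsto_integral_of_dominated_convergence (fun _ => 1)
    (fun m => (integrable_min_one_mul hr m).aestronglyMeasurable) (integrable_const _)
    (fun m => ?_) ?_
  · filter_upwards [hpos] with x hx
    rw [Real.norm_of_nonneg (by positivity)]
    exact min_le_left _ _
  · filter_upwards [hpos] with x hx
    refine tendsto_const_nhds.congr' ?_
    filter_upwards [(tendsto_natCast_atTop_atTop.atTop_mul_const hx).eventually_ge_atTop 1]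
      with m hm
    exact (min_eq_left hm).symm

theorem integral_min_one_mul_le (hr : Integrable r μ) (hm : MeasurableSet {x | 0 < r x}) (m : ℕ) :
    ∫ x, min 1 (m * r x) ∂μ ≤ μ.real {x | 0 < r x} := by
  rw [← integral_indicator_one hm]
  refine integral_mono (integrable_min_one_mul hr m) ((integrable_const (1 : ℝ)).indicator hm)
    fun x => ?_
  by_cases hx : 0 < r x
  · rw [indicator_of_mem (by exact hx)]
    exact min_le_left _ _
  · rw [indicator_of_notMem (by exact hx)]
    exact min_le_of_right_le (mul_nonpos_of_nonneg_of_nonpos m.cast_nonneg (not_lt.1 hx))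

-- `∫ min 1 (m r)` increases to `μ {r > 0}` as `m → ∞`, so positivity almost everywhere amounts to
-- countably many open conditions on the values of continuous functionals.
theorem isGδ_setOf_ae_pos : IsGδ {r : α →₁[μ] ℝ | ∀ᵐ x ∂μ, 0 < r x} := by
  have heq : {r : α →₁[μ] ℝ | ∀ᵐ x ∂μ, 0 < r x} =
      ⋂ n : ℕ, ⋃ m : ℕ, {r : α →₁[μ] ℝ |
        μ.real univ - 1 / ((n : ℝ) + 1) < ∫ x, min 1 (m * r x) ∂μ} := by
    ext r
    have hr := L1.integrable_coeFn r
    simp only [mem_ofPred_eq, mem_iInter, mem_iUnion]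
    constructor
    · intro hpos n
      exact ((tendsto_integral_min_one_mul hr hpos).eventually
        (lt_mem_nhds (sub_lt_self _ Nat.one_div_pos_of_nat))).exists
    · intro hlt
      have hmeas : MeasurableSet {x | 0 < r x} :=
        measurableSet_lt measurable_const (Lp.stronglyMeasurable r).measurable
      have hfull : μ.real univ ≤ μ.real {x | 0 < r x} := by
        refine le_of_forall_pos_lt_add fun ε hε => ?_
        obtain ⟨n, hn⟩ := exists_nat_one_div_lt hε
        obtain ⟨m, hm⟩ := hlt n
        linarith [integral_min_one_mul_le hr hmeas m]
      rw [ae_iff, ← measureReal_eq_zero_iff]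
      have := measureReal_compl (μ := μ) hmeas
      exact le_antisymm (this.trans_le (sub_nonpos.2 hfull)) measureReal_nonneg
  rw [heq]
  exact .iInter fun n => (isOpen_iUnion fun m =>
    isOpen_lt continuous_const (continuous_integral_min_one_mul m)).isGδ

end PositiveL1

namespace HplusAC

/-- The derivative as an isometric embedding of `H₊^{AC}` into `L¹`. -/
noncomputable def toL1 (f : HplusAC) : unitInterval →₁[volume] ℝ :=
  (hasDensity f).integrable.toL1 _

theorem isometry_toL1 : Isometry toL1 := by
  refine Isometry.of_dist_eq fun f g => ?_
  rw [dist_eq, toL1, toL1, dist_eq_norm, ← Integrable.toL1_sub, L1.norm_of_fun_eq_integral_norm]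
  rfl

theorem range_toL1 : range toL1 = {r | ∀ᵐ x, 0 < r x} ∩ {r | ∫ x, r x = 1} := by
  ext r
  constructor
  · rintro ⟨f, rfl⟩
    have hcoe := (hasDensity f).integrable.coeFn_toL1
    refine ⟨?_, (integral_congr_ae hcoe).trans (hasDensity f).integral_eq_one⟩
    filter_upwards [hcoe, density_pos_ae f] with x hx hpos
    rwa [toL1, hx]
  · rintro ⟨hpos, hint⟩
    obtain ⟨f, hf⟩ := exists_hasDensity (L1.integrable_coeFn r) hpos hint
    refine ⟨f, ?_⟩
    rw [toL1, ← Integrable.toL1_coeFn r (L1.integrable_coeFn r)]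
    exact (Integrable.toL1_eq_toL1_iff _ _ _ _).2 ((hasDensity f).ae_unique hf)

instance : BaireSpace HplusAC := by
  have hrange : IsGδ (range toL1) := range_toL1 ▸
    isGδ_setOf_ae_pos.inter (isClosed_eq continuous_integral continuous_const).isGδ
  have := baireSpace_of_isGδ hrange
  exact isometry_toL1.isEmbedding.toHomeomorph.symm.baireSpace

end HplusAC

/-! ### Orbitals -/

namespace Hplus

variable {f : Hplus} {a b c d x y : unitInterval} {J K : Set unitInterval}

theorem isClosed_Fix (f : Hplus) : IsClosed f.Fix := isClosed_eq f.continuous continuous_id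

theorem exists_fixed_mem_uIcc (hx : x < f x) (hy : f y < y) : ∃ w ∈ uIcc x y, f w = w := by
  obtain ⟨w, hw, hfw⟩ := isPreconnected_uIcc.intermediate_value₂ left_mem_uIcc right_mem_uIcc
    continuousOn_id f.continuous.continuousOn hx.le hy.le
  exact ⟨w, hw, hfw.symm⟩

theorem exists_fixed_mem_Ioo_of_pos_of_neg (hxy : x < y) (hx : x < f x) (hy : f y < y) :
    ∃ w ∈ Ioo x y, f w = w := by
  obtain ⟨w, hw, hfw⟩ := exists_fixed_mem_uIcc hx hy
  rw [uIcc_of_le hxy.le] at hw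
  refine ⟨w, ⟨hw.1.lt_of_ne ?_, hw.2.lt_of_ne ?_⟩, hfw⟩ <;> rintro rfl
  exacts [hx.ne' hfw, hy.ne hfw]

theorem exists_fixed_mem_Ioo_of_neg_of_pos (hxy : x < y) (hx : f x < x) (hy : y < f y) :
    ∃ w ∈ Ioo x y, f w = w := by
  obtain ⟨w, hw, hfw⟩ := exists_fixed_mem_uIcc hy hx
  rw [uIcc_of_ge hxy.le] at hw
  refine ⟨w, ⟨hw.1.lt_of_ne ?_, hw.2.lt_of_ne ?_⟩, hfw⟩ <;> rintro rfl
  exacts [hx.ne hfw, hy.ne' hfw]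

/-- `(a, b)` is a connected component of the complement of `Fix f`. Components are handled through
their endpoints, which are easier to compare than sets. -/
structure IsGap (f : Hplus) (a b : unitInterval) : Prop where
  lt : a < b
  left : f a = a
  right : f b = b
  ne : ∀ x ∈ Ioo a b, f x ≠ x

theorem exists_isGap (hx : f x ≠ x) : ∃ a b, f.IsGap a b ∧ x ∈ Ioo a b := by
  obtain ⟨a, ⟨ha, hax⟩, ha_max⟩ := (f.isClosed_Fix.inter isClosed_Iic).isCompact.exists_isGreatest
    (⟨0, f.map_zero, x.2.1⟩ : (f.Fix ∩ Iic x).Nonempty)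
  obtain ⟨b, ⟨hb, hxb⟩, hb_min⟩ := (f.isClosed_Fix.inter isClosed_Ici).isCompact.exists_isLeast
    (⟨1, f.map_one, x.2.2⟩ : (f.Fix ∩ Ici x).Nonempty)
  have hax' : a < x := lt_of_le_of_ne hax fun h => hx (h ▸ ha)
  have hxb' : x < b := lt_of_le_of_ne hxb fun h => hx (h ▸ hb)
  refine ⟨a, b, ⟨hax'.trans hxb', ha, hb, fun z hz hfz => ?_⟩, hax', hxb'⟩
  rcases le_total z x with hzx | hxz
  · exact hz.1.not_ge (ha_max ⟨hfz, hzx⟩)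
  · exact hz.2.not_ge (hb_min ⟨hfz, hxz⟩)

namespace IsGap

theorem le_left_of_fixed (h : f.IsGap a b) (hx : f x = x) (hxb : x < b) : x ≤ a :=
  le_of_not_gt fun hax => h.ne x ⟨hax, hxb⟩ hx

theorem right_le_of_fixed (h : f.IsGap a b) (hx : f x = x) (hax : a < x) : b ≤ x :=
  le_of_not_gt fun hxb => h.ne x ⟨hax, hxb⟩ hx

theorem orbital_eq (h : f.IsGap a b) (hx : x ∈ Ioo a b) : f.orbital x = Ioo a b := by
  have hxF : x ∈ f.Fixᶜ := h.ne x hx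
  rw [orbital, if_neg hxF]
  refine Subset.antisymm (fun y hy => ?_)
    (isPreconnected_Ioo.subset_connectedComponentIn hx fun z hz => h.ne z hz)
  have hord := (isPreconnected_connectedComponentIn (F := f.Fixᶜ) (x := x)).ordConnected
  have hx_mem := mem_connectedComponentIn hxF
  have hsub := connectedComponentIn_subset f.Fixᶜ x
  exact ⟨lt_of_not_ge fun hya => hsub (hord.out hy hx_mem ⟨hya, hx.1.le⟩) h.left,
    lt_of_not_ge fun hby => hsub (hord.out hx_mem hy ⟨hx.2.le, hby⟩) h.right⟩

theorem lt_apply (h : f.IsGap a b) (hx : x ∈ Ioo a b) (hy : y ∈ Ioo a b) (hfx : x < f x) :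
    y < f y := by
  refine (h.ne y hy).lt_or_gt.resolve_left fun hfy => ?_
  obtain ⟨w, hw, hfw⟩ := exists_fixed_mem_uIcc hfx hfy
  exact h.ne w (ordConnected_Ioo.uIcc_subset hx hy hw) hfw

theorem mem_nonzeroOrbitals (h : f.IsGap a b) : Ioo a b ∈ f.nonzeroOrbitals := by
  obtain ⟨x, hx⟩ := nonempty_Ioo.2 h.lt
  exact ⟨x, h.ne x hx, (h.orbital_eq hx).symm⟩

end IsGap

theorem mem_nonzeroOrbitals_iff : J ∈ f.nonzeroOrbitals ↔ ∃ a b, f.IsGap a b ∧ J = Ioo a b := by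
  constructor
  · rintro ⟨x, hx, rfl⟩
    obtain ⟨a, b, hab, hxab⟩ := exists_isGap hx
    exact ⟨a, b, hab, hab.orbital_eq hxab⟩
  · rintro ⟨a, b, hab, rfl⟩
    exact hab.mem_nonzeroOrbitals

theorem Ioo_mem_nonzeroOrbitals_iff : Ioo a b ∈ f.nonzeroOrbitals ↔ f.IsGap a b := by
  refine ⟨fun h => ?_, IsGap.mem_nonzeroOrbitals⟩
  obtain ⟨c, d, hcd, heq⟩ := mem_nonzeroOrbitals_iff.1 h
  have hab : a < b := nonempty_Ioo.1 (heq ▸ nonempty_Ioo.2 hcd.lt)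
  obtain rfl : a = c := by rw [← csInf_Ioo hab, heq, csInf_Ioo hcd.lt]
  obtain rfl : b = d := by rw [← csSup_Ioo hab, heq, csSup_Ioo hcd.lt]
  exact hcd

theorem mem_orbital (hx : f x ≠ x) : x ∈ f.orbital x := by
  obtain ⟨a, b, hab, hxab⟩ := exists_isGap hx
  rwa [hab.orbital_eq hxab]

theorem orbital_mem_nonzeroOrbitals (hx : f x ≠ x) : f.orbital x ∈ f.nonzeroOrbitals :=
  ⟨x, hx, rfl⟩

theorem apply_ne_of_mem (hJ : J ∈ f.nonzeroOrbitals) (hx : x ∈ J) : f x ≠ x := by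
  obtain ⟨a, b, hab, rfl⟩ := mem_nonzeroOrbitals_iff.1 hJ
  exact hab.ne x hx

theorem orbital_eq_of_mem (hJ : J ∈ f.nonzeroOrbitals) (hx : x ∈ J) : f.orbital x = J := by
  obtain ⟨a, b, hab, rfl⟩ := mem_nonzeroOrbitals_iff.1 hJ
  exact hab.orbital_eq hx

theorem nonempty_of_mem_nonzeroOrbitals (hJ : J ∈ f.nonzeroOrbitals) : J.Nonempty := by
  obtain ⟨a, b, hab, rfl⟩ := mem_nonzeroOrbitals_iff.1 hJ
  exact nonempty_Ioo.2 hab.lt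

theorem pairwiseDisjoint_nonzeroOrbitals : f.nonzeroOrbitals.PairwiseDisjoint id :=
  fun J hJ K hK hne => disjoint_left.2 fun x (hxJ : x ∈ J) (hxK : x ∈ K) =>
    hne ((orbital_eq_of_mem hJ hxJ).symm.trans (orbital_eq_of_mem hK hxK))

theorem countable_nonzeroOrbitals : f.nonzeroOrbitals.Countable := by
  refine pairwiseDisjoint_nonzeroOrbitals.countable_of_isOpen (fun J hJ => ?_)
    fun J hJ => nonempty_of_mem_nonzeroOrbitals hJ
  obtain ⟨a, b, -, rfl⟩ := mem_nonzeroOrbitals_iff.1 hJ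
  exact isOpen_Ioo

theorem mem_positiveOrbitals_iff (hJ : J ∈ f.nonzeroOrbitals) (hx : x ∈ J) :
    J ∈ f.positiveOrbitals ↔ x < f x := by
  refine ⟨?_, fun hfx => ⟨x, hfx, (orbital_eq_of_mem hJ hx).symm⟩⟩
  rintro ⟨y, hfy, rfl⟩
  obtain ⟨a, b, hab, hyab⟩ := exists_isGap hfy.ne'
  rw [hab.orbital_eq hyab] at hx
  exact hab.lt_apply hyab hx hfy

theorem mem_negativeOrbitals_iff (hJ : J ∈ f.nonzeroOrbitals) (hx : x ∈ J) :
    J ∈ f.negativeOrbitals ↔ f x < x := by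
  refine ⟨?_, fun hfx => ⟨x, hfx, (orbital_eq_of_mem hJ hx).symm⟩⟩
  rintro ⟨y, hfy, rfl⟩
  refine (apply_ne_of_mem hJ hx).lt_of_le (not_lt.1 fun hfx => hfy.not_gt ?_)
  exact (mem_positiveOrbitals_iff hJ (mem_orbital hfy.ne)).1
    ((mem_positiveOrbitals_iff hJ hx).2 hfx)

theorem mem_nonzeroOrbitals_of_mem_positiveOrbitals (hJ : J ∈ f.positiveOrbitals) :
    J ∈ f.nonzeroOrbitals := by
  obtain ⟨x, hx, rfl⟩ := hJ
  exact orbital_mem_nonzeroOrbitals hx.ne'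

theorem mem_nonzeroOrbitals_of_mem_negativeOrbitals (hJ : J ∈ f.negativeOrbitals) :
    J ∈ f.nonzeroOrbitals := by
  obtain ⟨x, hx, rfl⟩ := hJ
  exact orbital_mem_nonzeroOrbitals hx.ne

theorem precedes_Ioo_iff (hab : a < b) (hcd : c < d) : Precedes (Ioo a b) (Ioo c d) ↔ b ≤ c := by
  refine ⟨fun h => le_of_not_gt fun hcb => ?_, fun hbc x hx y hy => hx.2.trans (hbc.trans_lt hy.1)⟩
  obtain ⟨y, hcy, hy⟩ := exists_between (lt_min hcb hcd)
  obtain ⟨x, hx, hxb⟩ := exists_between (max_lt hab (lt_min_iff.1 hy).1)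
  rw [max_lt_iff] at hx
  exact hx.2.not_gt (h x ⟨hx.1, hxb⟩ y ⟨hcy, (lt_min_iff.1 hy).2⟩)

theorem precedes_orbital_iff (hx : f x ≠ x) (hy : f y ≠ y) :
    Precedes (f.orbital x) (f.orbital y) ↔ ∃ w ∈ Ioo x y, f w = w := by
  obtain ⟨a, b, hab, hxab⟩ := exists_isGap hx
  obtain ⟨c, d, hcd, hycd⟩ := exists_isGap hy
  rw [hab.orbital_eq hxab, hcd.orbital_eq hycd, precedes_Ioo_iff hab.lt hcd.lt]
  refine ⟨fun hbc => ⟨b, ⟨hxab.2, hbc.trans_lt hycd.1⟩, hab.right⟩, ?_⟩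
  rintro ⟨w, hw, hfw⟩
  exact (hab.right_le_of_fixed hfw (hxab.1.trans hw.1)).trans
    (hcd.le_left_of_fixed hfw (hw.2.trans hycd.2))

theorem Precedes.trans {L : Set unitInterval} (hJK : Precedes J K) (hKL : Precedes K L)
    (hK : K.Nonempty) : Precedes J L := fun x hx z hz =>
  let ⟨y, hy⟩ := hK
  (hJK x hx y hy).trans (hKL y hy z hz)

theorem isStrictTotalOrder_precedes (f : Hplus) :
    IsStrictTotalOrder f.nonzeroOrbitals fun J K => Precedes J.1 K.1 where
  irrefl J hJ :=
    let ⟨x, hx⟩ := nonempty_of_mem_nonzeroOrbitals J.2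
    lt_irrefl x (hJ x hx x hx)
  trans _ K _ hJK hKL := hJK.trans hKL (nonempty_of_mem_nonzeroOrbitals K.2)
  trichotomous := by
    rintro ⟨J, hJ⟩ ⟨K, hK⟩ hJK hKJ
    obtain ⟨a, b, hab, rfl⟩ := mem_nonzeroOrbitals_iff.1 hJ
    obtain ⟨c, d, hcd, rfl⟩ := mem_nonzeroOrbitals_iff.1 hK
    simp only [precedes_Ioo_iff hab.lt hcd.lt, precedes_Ioo_iff hcd.lt hab.lt, not_le] at hJK hKJ
    obtain rfl : a = c := le_antisymm (hcd.le_left_of_fixed hab.left hKJ)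
      (hab.le_left_of_fixed hcd.left hJK)
    obtain rfl : b = d := le_antisymm (hab.right_le_of_fixed hcd.right hcd.lt)
      (hcd.right_le_of_fixed hab.right hab.lt)
    rfl

end Hplus

/-! ### Alternating homeomorphisms -/

namespace Hplus

variable {f : Hplus} {a b c d x y z : unitInterval} {U : Set unitInterval}

/-- `f - id` takes positive, negative and positive values, in this order, on `B`. -/
def AlternatesOn (f : Hplus) (B : Set unitInterval) : Prop :=
  ∃ x₁ ∈ B, ∃ x₂ ∈ B, ∃ x₃ ∈ B,
    x₁ < x₂ ∧ x₂ < x₃ ∧ x₁ < f x₁ ∧ f x₂ < x₂ ∧ x₃ < f x₃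

theorem AlternatesOn.mono {B B' : Set unitInterval} (hf : f.AlternatesOn B) (h : B ⊆ B') :
    f.AlternatesOn B' := by
  obtain ⟨x₁, hx₁, x₂, hx₂, x₃, hx₃, hf⟩ := hf
  exact ⟨x₁, h hx₁, x₂, h hx₂, x₃, h hx₃, hf⟩

/-- `f - id` changes sign twice, from positive to negative and back, in every neighbourhood of every
fixed point of `f`. This is the form in which the condition on the order of the orbitals is shown
to be generic. -/
def IsAlternating (f : Hplus) : Prop := ∀ z, f z = z → ∀ U ∈ 𝓝 z, f.AlternatesOn U

theorem IsAlternating.exists_fixed_lt_fixed (hf : f.IsAlternating) (hz : f z = z) (hU : U ∈ 𝓝 z) :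
    ∃ w₁ ∈ U, ∃ w₂ ∈ U, w₁ < w₂ ∧ f w₁ = w₁ ∧ f w₂ = w₂ := by
  obtain ⟨p, q, -, hpq, hsub⟩ := exists_Icc_mem_subset_of_mem_nhds hU
  obtain ⟨x₁, hx₁, x₂, hx₂, x₃, hx₃, h₁₂, h₂₃, hpos₁, hneg₂, hpos₃⟩ := hf z hz _ hpq
  obtain ⟨w₁, hw₁, hfw₁⟩ := exists_fixed_mem_Ioo_of_pos_of_neg h₁₂ hpos₁ hneg₂
  obtain ⟨w₂, hw₂, hfw₂⟩ := exists_fixed_mem_Ioo_of_neg_of_pos h₂₃ hneg₂ hpos₃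
  exact ⟨w₁, hsub (ordConnected_Icc.out hx₁ hx₂ (Ioo_subset_Icc_self hw₁)), w₂,
    hsub (ordConnected_Icc.out hx₂ hx₃ (Ioo_subset_Icc_self hw₂)), hw₁.2.trans hw₂.1, hfw₁, hfw₂⟩

theorem IsAlternating.preperfect_Fix (hf : f.IsAlternating) : Preperfect f.Fix := by
  refine fun z hz => accPt_iff_nhds.2 fun U hU => ?_
  obtain ⟨w₁, hw₁, w₂, hw₂, hlt, hfw₁, hfw₂⟩ := hf.exists_fixed_lt_fixed hz hU
  rcases eq_or_ne w₁ z with rfl | hne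
  exacts [⟨w₂, ⟨hw₂, hfw₂⟩, hlt.ne'⟩, ⟨w₁, ⟨hw₁, hfw₁⟩, hne⟩]

theorem IsAlternating.exists_neg_pos_between (hf : f.IsAlternating) (hab : f.IsGap a b)
    (hbc : b < c) : ∃ x ∈ Ioo b c, ∃ y ∈ Ioo b c, f x < x ∧ y < f y := by
  obtain ⟨w₁, hw₁, w₂, hw₂, hlt, hfw₁, hfw₂⟩ :=
    hf.exists_fixed_lt_fixed hab.right (Ioo_mem_nhds hab.lt hbc)
  obtain ⟨x₁, hx₁, x₂, hx₂, -, -, -, -, hpos, hneg, -⟩ := hf w₂ hfw₂ (Ioo b c)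
    (Ioo_mem_nhds ((hab.right_le_of_fixed hfw₁ hw₁.1).trans_lt hlt) hw₂.2)
  exact ⟨x₂, hx₂, x₁, hx₁, hneg, hpos⟩

theorem exists_apply_ne_mem_Ioo (hnull : volume f.Fix = 0) (hxy : x < y) :
    ∃ v ∈ Ioo x y, f v ≠ v := by
  by_contra! hfix
  exact (isOpen_Ioo.measure_pos volume (nonempty_Ioo.2 hxy)).ne' (measure_mono_null hfix hnull)

theorem isTotallyDisconnected_Fix (hnull : volume f.Fix = 0) : IsTotallyDisconnected f.Fix := by
  intro t ht hpre x hx y hy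
  by_contra hne
  obtain ⟨v, hv, hfv⟩ := exists_apply_ne_mem_Ioo hnull (inf_lt_sup.2 hne)
  exact hfv (ht (hpre.ordConnected.uIcc_subset hx hy (Ioo_subset_Icc_self hv)))

theorem exists_fixed_lt_of_preperfect (hperf : Preperfect f.Fix) (hab : f.IsGap a b) :
    ∃ w < a, f w = w := by
  obtain ⟨w, ⟨hwb, hfw⟩, hne⟩ := accPt_iff_nhds.1 (hperf a hab.left) _ (Iio_mem_nhds hab.lt)
  exact ⟨w, (hab.le_left_of_fixed hfw hwb).lt_of_ne hne, hfw⟩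

theorem exists_fixed_gt_of_preperfect (hperf : Preperfect f.Fix) (hab : f.IsGap a b) :
    ∃ w > b, f w = w := by
  obtain ⟨w, ⟨haw, hfw⟩, hne⟩ := accPt_iff_nhds.1 (hperf b hab.right) _ (Ioi_mem_nhds hab.lt)
  exact ⟨w, (hab.right_le_of_fixed hfw haw).lt_of_ne hne.symm, hfw⟩

theorem lt_of_precedes_of_preperfect (hperf : Preperfect f.Fix) (hab : f.IsGap a b)
    (hcd : f.IsGap c d) (h : Precedes (Ioo a b) (Ioo c d)) : b < c := by
  refine ((precedes_Ioo_iff hab.lt hcd.lt).1 h).lt_of_ne ?_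
  rintro rfl
  obtain ⟨w, ⟨hw, hfw⟩, hne⟩ :=
    accPt_iff_nhds.1 (hperf b hab.right) _ (Ioo_mem_nhds hab.lt hcd.lt)
  rcases lt_or_gt_of_ne hne with hlt | hgt
  exacts [hab.ne w ⟨hw.1, hlt⟩ hfw, hcd.ne w ⟨hgt, hw.2⟩ hfw]

theorem exists_orbital_between_of_preperfect (hperf : Preperfect f.Fix)
    (hbetween : ∀ a b c d, f.IsGap a b → f.IsGap c d → b < c →
      ∃ x ∈ Ioo b c, ∃ y ∈ Ioo b c, f x < x ∧ y < f y) {J K : Set unitInterval}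
    (hJ : J ∈ f.nonzeroOrbitals) (hK : K ∈ f.nonzeroOrbitals) (hJK : Precedes J K) :
    (∃ L ∈ f.positiveOrbitals, Precedes J L ∧ Precedes L K) ∧
      ∃ L ∈ f.negativeOrbitals, Precedes J L ∧ Precedes L K := by
  obtain ⟨u, hu, rfl⟩ := hJ
  obtain ⟨v, hv, rfl⟩ := hK
  obtain ⟨a, b, hab, hu_mem⟩ := exists_isGap hu
  obtain ⟨c, d, hcd, hv_mem⟩ := exists_isGap hv
  have hbc := lt_of_precedes_of_preperfect hperf hab hcd
    (hab.orbital_eq hu_mem ▸ hcd.orbital_eq hv_mem ▸ hJK)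
  have hprecedes {w : unitInterval} (hw : w ∈ Ioo b c) (hfw : f w ≠ w) :
      Precedes (f.orbital u) (f.orbital w) ∧ Precedes (f.orbital w) (f.orbital v) :=
    ⟨(precedes_orbital_iff hu hfw).2 ⟨b, ⟨hu_mem.2, hw.1⟩, hab.right⟩,
      (precedes_orbital_iff hfw hv).2 ⟨c, ⟨hw.2, hv_mem.1⟩, hcd.left⟩⟩
  obtain ⟨x, hx, y, hy, hfx, hfy⟩ := hbetween a b c d hab hcd hbc
  exact ⟨⟨_, ⟨y, hfy, rfl⟩, hprecedes hy hfy.ne'⟩, _, ⟨x, hfx, rfl⟩, hprecedes hx hfx.ne⟩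

theorem mem_setC_of_preperfect (hperf : Preperfect f.Fix) (hnull : volume f.Fix = 0)
    (hbetween : ∀ a b c d, f.IsGap a b → f.IsGap c d → b < c →
      ∃ x ∈ Ioo b c, ∃ y ∈ Ioo b c, f x < x ∧ y < f y) : f ∈ setC := by
  have horbital {J} (hJ : J ∈ f.nonzeroOrbitals) {K} (hK : K ∈ f.nonzeroOrbitals)
      (hJK : Precedes J K) := exists_orbital_between_of_preperfect hperf hbetween hJ hK hJK
  refine ⟨?_, f.isStrictTotalOrder_precedes, fun J hJ K hK h => ?_, ?_, ?_,
    fun J hJ K hK h => (horbital hJ hK h).1, fun J hJ K hK h => (horbital hJ hK h).2⟩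
  · obtain ⟨v, -, hfv⟩ := exists_apply_ne_mem_Ioo hnull (zero_lt_one (α := unitInterval))
    exact ⟨_, orbital_mem_nonzeroOrbitals hfv⟩
  · obtain ⟨L, hL, hJLK⟩ := (horbital hJ hK h).1
    exact ⟨L, mem_nonzeroOrbitals_of_mem_positiveOrbitals hL, hJLK⟩
  · rintro _ ⟨u, hu, rfl⟩
    obtain ⟨a, b, hab, hu_mem⟩ := exists_isGap hu
    obtain ⟨w, hwa, -⟩ := exists_fixed_lt_of_preperfect hperf hab
    obtain ⟨v, hv, hfv⟩ := exists_apply_ne_mem_Ioo hnull hwa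
    exact ⟨_, orbital_mem_nonzeroOrbitals hfv,
      (precedes_orbital_iff hfv hu).2 ⟨a, ⟨hv.2, hu_mem.1⟩, hab.left⟩⟩
  · rintro _ ⟨u, hu, rfl⟩
    obtain ⟨a, b, hab, hu_mem⟩ := exists_isGap hu
    obtain ⟨w, hbw, -⟩ := exists_fixed_gt_of_preperfect hperf hab
    obtain ⟨v, hv, hfv⟩ := exists_apply_ne_mem_Ioo hnull hbw
    exact ⟨_, orbital_mem_nonzeroOrbitals hfv,
      (precedes_orbital_iff hu hfv).2 ⟨b, ⟨hu_mem.2, hv.1⟩, hab.right⟩⟩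

theorem exists_precedes_Icc_subset_of_mem_setC (hf : f ∈ setC) (hnull : volume f.Fix = 0)
    (hz : f z = z) (hU : U ∈ 𝓝 z) :
    ∃ x y, f x ≠ x ∧ f y ≠ y ∧ Precedes (f.orbital x) (f.orbital y) ∧ Icc x y ⊆ U := by
  obtain ⟨-, -, -, hleft, hright, -, -⟩ := hf
  rcases eq_or_ne z 0 with rfl | hz0
  · obtain ⟨u, hu, hsub⟩ := exists_Ico_subset_of_mem_nhds hU ⟨1, zero_lt_one⟩
    obtain ⟨y, hy, hfy⟩ := exists_apply_ne_mem_Ioo hnull hu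
    obtain ⟨_, ⟨x, hfx, rfl⟩, hxy⟩ := hleft _ (orbital_mem_nonzeroOrbitals hfy)
    exact ⟨x, y, hfx, hfy, hxy, fun v hv => hsub ⟨v.2.1, hv.2.trans_lt hy.2⟩⟩
  rcases eq_or_ne z 1 with rfl | hz1
  · obtain ⟨u, hu, hsub⟩ := exists_Ioc_subset_of_mem_nhds hU ⟨0, zero_lt_one⟩
    obtain ⟨x, hx, hfx⟩ := exists_apply_ne_mem_Ioo hnull hu
    obtain ⟨_, ⟨y, hfy, rfl⟩, hxy⟩ := hright _ (orbital_mem_nonzeroOrbitals hfx)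
    exact ⟨x, y, hfx, hfy, hxy, fun v hv => hsub ⟨hx.1.trans_le hv.1, v.2.2⟩⟩
  · obtain ⟨l, u, hzlu, hsub⟩ := (mem_nhds_iff_exists_Ioo_subset'
      ⟨0, unitInterval.pos_iff_ne_zero.2 hz0⟩ ⟨1, unitInterval.lt_one_iff_ne_one.2 hz1⟩).1 hU
    obtain ⟨x, hx, hfx⟩ := exists_apply_ne_mem_Ioo hnull hzlu.1
    obtain ⟨y, hy, hfy⟩ := exists_apply_ne_mem_Ioo hnull hzlu.2
    exact ⟨x, y, hfx, hfy, (precedes_orbital_iff hfx hfy).2 ⟨z, ⟨hx.2, hy.1⟩, hz⟩,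
      fun v hv => hsub ⟨hx.1.trans_le hv.1, hv.2.trans_lt hy.2⟩⟩

theorem isAlternating_of_mem_setC (hf : f ∈ setC) (hnull : volume f.Fix = 0) :
    f.IsAlternating := by
  intro z hz U hU
  obtain ⟨x, y, hx, hy, hxy, hsub⟩ := exists_precedes_Icc_subset_of_mem_setC hf hnull hz hU
  obtain ⟨-, -, -, -, -, hpos, hneg⟩ := hf
  have hlt {u v : unitInterval} (hu : f u ≠ u) (hv : f v ≠ v)
      (h : Precedes (f.orbital u) (f.orbital v)) : u < v := h u (mem_orbital hu) v (mem_orbital hv)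
  have horb {u : unitInterval} (hu : f u ≠ u) := orbital_mem_nonzeroOrbitals hu
  obtain ⟨_, ⟨x₁, hx₁, rfl⟩, hxx₁, hx₁y⟩ := hpos _ (horb hx) _ (horb hy) hxy
  obtain ⟨_, ⟨x₂, hx₂, rfl⟩, hx₁x₂, hx₂y⟩ := hneg _ (horb hx₁.ne') _ (horb hy) hx₁y
  obtain ⟨_, ⟨x₃, hx₃, rfl⟩, hx₂x₃, hx₃y⟩ := hpos _ (horb hx₂.ne) _ (horb hy) hx₂y
  have h₁ := hlt hx hx₁.ne' hxx₁
  have h₁₂ := hlt hx₁.ne' hx₂.ne hx₁x₂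
  have h₂₃ := hlt hx₂.ne hx₃.ne' hx₂x₃
  have h₃ := hlt hx₃.ne' hy hx₃y
  exact ⟨x₁, hsub ⟨h₁.le, (h₁₂.trans (h₂₃.trans h₃)).le⟩,
    x₂, hsub ⟨(h₁.trans h₁₂).le, (h₂₃.trans h₃).le⟩,
    x₃, hsub ⟨((h₁.trans h₁₂).trans h₂₃).le, h₃.le⟩, h₁₂, h₂₃, hx₁, hx₂, hx₃⟩

theorem volume_Fix_eq_zero_iff : volume f.Fix = 0 ↔ f ∈ setN := by
  rw [unitInterval.volume_apply]
  rfl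

theorem mem_setC_inter_setN_iff_isTotallyDisconnected_Fix :
    f ∈ setC ∩ setN ↔ (IsTotallyDisconnected f.Fix ∧ Preperfect f.Fix) ∧
      (∀ a b c d : unitInterval, Ioo a b ∈ f.nonzeroOrbitals → Ioo c d ∈ f.nonzeroOrbitals →
        b < c → ∃ x ∈ Ioo b c, ∃ y ∈ Ioo b c, f x < x ∧ y < f y) ∧
      volume ((fun x : unitInterval => (x : ℝ)) '' f.Fix) = 0 := by
  simp only [Ioo_mem_nonzeroOrbitals_iff]
  constructor
  · rintro ⟨hC, hN⟩
    have hnull := volume_Fix_eq_zero_iff.2 hN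
    have halt := isAlternating_of_mem_setC hC hnull
    exact ⟨⟨isTotallyDisconnected_Fix hnull, halt.preperfect_Fix⟩,
      fun _ _ _ _ hab _ hbc => halt.exists_neg_pos_between hab hbc, hN⟩
  · rintro ⟨⟨-, hperf⟩, hbetween, hN⟩
    exact ⟨mem_setC_of_preperfect hperf (volume_Fix_eq_zero_iff.2 hN) hbetween, hN⟩

theorem mem_setC_inter_setN_iff_isAlternating :
    f ∈ setC ∩ setN ↔ f.IsAlternating ∧ volume f.Fix = 0 := by
  rw [mem_inter_iff, ← volume_Fix_eq_zero_iff]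
  refine and_congr_left fun hnull => ⟨fun hC => isAlternating_of_mem_setC hC hnull, fun halt => ?_⟩
  exact mem_setC_of_preperfect halt.preperfect_Fix hnull fun _ _ _ _ hab _ hbc =>
    halt.exists_neg_pos_between hab hbc

end Hplus

/-! ### The generic set is a dense Gδ set -/

namespace Hplus

theorem disjoint_Fix_of_convexCombination {f k g g' : Hplus} {s t : ℝ}
    (hk : ∀ x ∈ Ioo (0 : unitInterval) 1, x < k x) (hst : s ≠ t)
    (hg : ∀ x, (g x : ℝ) = (1 - s) * f x + s * k x)
    (hg' : ∀ x, (g' x : ℝ) = (1 - t) * f x + t * k x) :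
    Disjoint (g.Fix ∩ Ioo 0 1) (g'.Fix ∩ Ioo 0 1) := by
  rw [Set.disjoint_left]
  rintro x ⟨hgx, hx⟩ ⟨hg'x, -⟩
  have hs : (x : ℝ) = (1 - s) * f x + s * k x := by rw [← hg, hgx]
  have ht : (x : ℝ) = (1 - t) * f x + t * k x := by rw [← hg', hg'x]
  have hfk : (f x : ℝ) = k x :=
    mul_left_cancel₀ (sub_ne_zero.2 hst) (by linear_combination hs - ht)
  have hlt : (x : ℝ) < k x := hk x hx
  rw [hfk] at hs
  linarith

end Hplus

namespace HplusAC

variable {B K : Set unitInterval} {a b p q x y z : unitInterval}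

theorem isOpen_setOf_disjoint_Fix (hK : IsClosed K) :
    IsOpen {f : HplusAC | Disjoint f.1.Fix K} := by
  have hclosed : IsClosed {p : HplusAC × unitInterval | p.1.1 p.2 = p.2 ∧ p.2 ∈ K} :=
    (isClosed_eq continuous_eval continuous_snd).inter (hK.preimage continuous_snd)
  rw [← isClosed_compl_iff]
  convert isClosedMap_fst_of_compactSpace _ hclosed
  ext f
  simp [not_disjoint_iff, Hplus.Fix]

theorem isGδ_setOf_disjoint_Fix (hB : IsOpen B) : IsGδ {f : HplusAC | Disjoint f.1.Fix B} := by
  obtain ⟨K, hK, -, rfl, -⟩ := hB.exists_iUnion_isClosed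
  simp only [disjoint_iUnion_right, ofPred_forall]
  exact .iInter fun n => (isOpen_setOf_disjoint_Fix (hK n)).isGδ

theorem isOpen_setOf_volume_Fix_lt (r : ENNReal) :
    IsOpen {f : HplusAC | volume f.1.Fix < r} := by
  refine isOpen_iff_mem_nhds.2 fun f hf => ?_
  obtain ⟨U, hfU, hU, hUr⟩ := f.1.Fix.exists_isOpen_lt_of_lt r hf
  filter_upwards [(isOpen_setOf_disjoint_Fix hU.isClosed_compl).mem_nhds
    (disjoint_compl_right_iff_subset.2 hfU)] with g hg
  exact (measure_mono (disjoint_compl_right_iff_subset.1 hg)).trans_lt hUr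

theorem isGδ_setOf_volume_Fix_eq_zero : IsGδ {f : HplusAC | volume f.1.Fix = 0} := by
  have hinter : {f : HplusAC | volume f.1.Fix = 0} =
      ⋂ n : ℕ, {f : HplusAC | volume f.1.Fix < ((n : ENNReal) + 1)⁻¹} := by
    ext f
    simp only [mem_ofPred_eq, mem_iInter]
    refine ⟨fun h n => by simp [h], fun h => ?_⟩
    by_contra hne
    obtain ⟨n, hn⟩ := ENNReal.exists_inv_nat_lt hne
    exact ((h n).trans_le (ENNReal.inv_le_inv.2 le_self_add)).not_gt hn
  rw [hinter]
  exact .iInter fun n => (isOpen_setOf_volume_Fix_lt _).isGδ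

theorem exists_convexCombination (f k : HplusAC) {t : ℝ} (ht : t ∈ Ioo (0 : ℝ) 1) :
    ∃ g : HplusAC, (∀ x, (g.1 x : ℝ) = (1 - t) * f.1 x + t * k.1 x) ∧
      dist f g = t * dist f k := by
  have hf := hasDensity f
  have hk := hasDensity k
  have hf_int := hf.integrable.const_mul (1 - t)
  have hk_int := hk.integrable.const_mul t
  obtain ⟨g, hg⟩ := exists_hasDensity (hf_int.add hk_int)
    (by
      filter_upwards [density_pos_ae f, density_pos_ae k] with x hfx hkx
      exact add_pos (mul_pos (sub_pos.2 ht.2) hfx) (mul_pos ht.1 hkx))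
    (by
      rw [integral_add' hf_int hk_int, integral_const_mul, integral_const_mul,
        hf.integral_eq_one, hk.integral_eq_one]
      ring)
  refine ⟨g, fun x => ?_, ?_⟩
  · rw [hg.apply_eq, integral_add' hf_int.integrableOn hk_int.integrableOn, integral_const_mul,
      integral_const_mul, ← hf.apply_eq, ← hk.apply_eq]
  · rw [dist_eq, dist_eq, ← integral_const_mul]
    refine integral_congr_ae ?_
    filter_upwards [(hasDensity g).ae_unique hg] with x hx
    rw [hx, Pi.add_apply, ← abs_of_pos ht.1, ← abs_mul, abs_of_pos ht.1]
    ring_nf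

theorem exists_lt_apply : ∃ k : HplusAC, ∀ x ∈ Ioo (0 : unitInterval) 1, x < k.1 x := by
  have hcont : Continuous fun y : ℝ => 2 - 2 * y := by fun_prop
  have hint (x : ℝ) : ∫ y in (0 : ℝ)..x, (2 - 2 * y) = 2 * x - x ^ 2 := by
    rw [intervalIntegral.integral_eq_sub_of_hasDerivAt (f := fun y => 2 * y - y ^ 2)
      (fun y _ => by simpa using! ((hasDerivAt_id y).const_mul 2).sub (hasDerivAt_pow 2 y))
      (hcont.intervalIntegrable _ _)]
    ring
  obtain ⟨k, hk⟩ := exists_hasDensity (r := fun x => 2 - 2 * (x : ℝ))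
    (integrable_coe_iff_intervalIntegrable.2 (hcont.intervalIntegrable _ _))
    (by
      filter_upwards [compl_mem_ae_iff.2 (measure_singleton (μ := volume) (1 : unitInterval))]
        with x hx
      have hx1 : (x : ℝ) < 1 := unitInterval.lt_one_iff_ne_one.2 hx
      linarith)
    (by rw [integral_coe fun y => 2 - 2 * y, hint]; norm_num)
  refine ⟨k, fun x hx => Subtype.coe_lt_coe.1 ?_⟩
  rw [hk.apply_eq, setIntegral_Iic_coe fun y => 2 - 2 * y, hint]
  have hx0 : (0 : ℝ) < x := hx.1
  have hx1 : (x : ℝ) < 1 := hx.2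
  nlinarith

-- The convex combinations of `f` with a map above the identity have pairwise disjoint sets of
-- interior fixed points, so all but countably many of these sets are null.
theorem dense_setOf_volume_Fix_eq_zero : Dense {f : HplusAC | volume f.1.Fix = 0} := by
  refine Metric.dense_iff.2 fun f ε hε => ?_
  obtain ⟨k, hk⟩ := exists_lt_apply
  choose g hg hdist using fun t : Ioo (0 : ℝ) 1 => exists_convexCombination f k t.2
  have hcount : {t : Ioo (0 : ℝ) 1 | 0 < volume ((g t).1.Fix ∩ Ioo 0 1)}.Countable :=
    Measure.countable_meas_pos_of_disjoint_iUnion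
      (fun t => (g t).1.isClosed_Fix.measurableSet.inter measurableSet_Ioo)
      fun s t hst => Hplus.disjoint_Fix_of_convexCombination hk
        (Subtype.coe_injective.ne hst) (hg s) (hg t)
  have hδ : 0 < min 1 (ε / (dist f k + 1)) := lt_min one_pos (by positivity)
  obtain ⟨t, ht_notMem, ht⟩ := ((hcount.image Subtype.val).dense_compl ℝ).exists_mem_open
    isOpen_Ioo (nonempty_Ioo.2 hδ)
  have ht01 : t ∈ Ioo (0 : ℝ) 1 := ⟨ht.1, ht.2.trans_le (min_le_left _ _)⟩
  refine ⟨g ⟨t, ht01⟩, ?_, ?_⟩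
  · have hmul : t * (dist f k + 1) < ε :=
      (lt_div_iff₀ (by positivity)).1 (ht.2.trans_le (min_le_right _ _))
    rw [Metric.mem_ball, dist_comm, hdist]
    linarith [ht.1]
  · have hnull : volume ((g ⟨t, ht01⟩).1.Fix ∩ Ioo 0 1) = 0 := by
      by_contra hne
      exact ht_notMem ⟨⟨t, ht01⟩, pos_iff_ne_zero.2 hne, rfl⟩
    have hends : volume ({0, 1} : Set unitInterval) = 0 := (toFinite _).measure_zero _
    refine measure_mono_null (fun x hx => ?_) (measure_union_null hnull hends)
    rcases eq_or_ne x 0 with rfl | hx0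
    · exact Or.inr (Or.inl rfl)
    rcases eq_or_ne x 1 with rfl | hx1
    · exact Or.inr (Or.inr rfl)
    exact Or.inl ⟨hx, unitInterval.pos_iff_ne_zero.2 hx0, unitInterval.lt_one_iff_ne_one.2 hx1⟩

theorem dist_le_of_eqOn_compl_Ioo {f g : HplusAC} (hab : a ≤ b)
    (hfg : EqOn f.1 g.1 (Ioo a b)ᶜ) : dist f g ≤ 2 * (f.1 b - f.1 a) := by
  have hf := hasDensity f
  have hg := hasDensity g
  have hdensity (x : unitInterval) (hx : x ∉ Icc a b) : f.1.density x = g.1.density x := by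
    have hnhds : (Icc (a : ℝ) b)ᶜ ∈ 𝓝 (x : ℝ) := isClosed_Icc.isOpen_compl.mem_nhds hx
    refine EventuallyEq.deriv_eq ?_
    filter_upwards [hnhds] with u hu
    refine congrArg _ (hfg fun hproj => hu ?_)
    have hu01 : u ∈ Icc (0 : ℝ) 1 := by
      refine ⟨?_, ?_⟩ <;> by_contra! hlt
      · exact absurd hproj.1 (by rw [projIcc_of_le_left _ hlt.le]; exact a.2.1.not_gt)
      · exact absurd hproj.2 (by rw [projIcc_of_right_le _ hlt.le]; exact b.2.2.not_gt)
    rw [projIcc_of_mem _ hu01] at hproj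
    exact ⟨hproj.1.le, hproj.2.le⟩
  rw [dist_eq]
  calc ∫ x, |f.1.density x - g.1.density x|
      = ∫ x in Ioc a b, |f.1.density x - g.1.density x| := by
        rw [← integral_Icc_eq_integral_Ioc]
        refine (setIntegral_eq_integral_of_forall_compl_eq_zero fun x hx => ?_).symm
        rw [hdensity x hx, sub_self, abs_zero]
    _ ≤ ∫ x in Ioc a b, (f.1.density x + g.1.density x) := by
        refine setIntegral_mono_ae (hf.integrable.sub hg.integrable).abs.integrableOn
          (hf.integrable.add hg.integrable).integrableOn ?_
        filter_upwards [hf.nonneg, hg.nonneg] with x hfx hgx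
        exact (abs_sub _ _).trans_eq (by rw [abs_of_nonneg hfx, abs_of_nonneg hgx])
    _ = 2 * (f.1 b - f.1 a) := by
        rw [integral_add hf.integrable.integrableOn hg.integrable.integrableOn,
          hf.setIntegral_Ioc hab, hg.setIntegral_Ioc hab,
          ← hfg (fun h => h.1.false : a ∉ Ioo a b), ← hfg (fun h => h.2.false : b ∉ Ioo a b)]
        ring

theorem setIntegral_Iic_indicator_Ioc (c : ℝ) (a b x : unitInterval) :
    ∫ y in Iic x, (Ioc a b).indicator (fun _ => c) y = max (min (b : ℝ) x - a) 0 * c := by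
  rw [setIntegral_indicator measurableSet_Ioc, inter_comm, Ioc_inter_Iic, setIntegral_const,
    Measure.real, unitInterval.volume_Ioc, ENNReal.toReal_ofReal', smul_eq_mul]
  rfl

-- `g` has slope `1 + c` on `[a, p]`, slope `1 + d` on `[p, b]` and slope `1` elsewhere.
theorem exists_add_ramps (hap : a < p) (hpb : p < b) {c d : ℝ} (hc : -1 < c) (hd : -1 < d)
    (hcd : (p - a) * c + (b - p) * d = 0) :
    ∃ g : HplusAC, ∀ x,
      (g.1 x : ℝ) = x + max (min (p : ℝ) x - a) 0 * c + max (min (b : ℝ) x - p) 0 * d := by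
  set r : unitInterval → ℝ :=
    1 + (Ioc a p).indicator (fun _ => c) + (Ioc p b).indicator fun _ => d
  have hone : Integrable (1 : unitInterval → ℝ) := integrable_const 1
  have hindicator (e : ℝ) (u v : unitInterval) :
      Integrable ((Ioc u v).indicator fun _ => e) :=
    (integrable_const e).indicator measurableSet_Ioc
  have hpos (x : unitInterval) : 0 < r x := by
    simp only [r, Pi.add_apply, Pi.one_apply, indicator_apply]
    split_ifs with hx hx'
    · exact absurd hx.2 hx'.1.not_ge
    all_goals linarith
  have hr : Integrable r := (hone.add (hindicator c a p)).add (hindicator d p b)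
  have hintegral (x : unitInterval) :
      ∫ y in Iic x, r y = x + max (min (p : ℝ) x - a) 0 * c + max (min (b : ℝ) x - p) 0 * d := by
    rw [integral_add' (hone.add (hindicator c a p)).integrableOn (hindicator d p b).integrableOn,
      integral_add' hone.integrableOn (hindicator c a p).integrableOn,
      setIntegral_Iic_indicator_Ioc, setIntegral_Iic_indicator_Ioc]
    simp [Measure.real, x.2.1]
  obtain ⟨g, hg⟩ := exists_hasDensity hr (ae_of_all _ hpos) (by
    rw [← setIntegral_Iic_one, hintegral, Icc.coe_one, min_eq_left p.2.2, min_eq_left b.2.2,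
      max_eq_left (sub_nonneg.2 (Subtype.coe_le_coe.2 hap.le)),
      max_eq_left (sub_nonneg.2 (Subtype.coe_le_coe.2 hpb.le))]
    linarith)
  exact ⟨g, fun x => (hg.apply_eq x).trans (hintegral x)⟩

theorem exists_apply_eq_and_eqOn_id_compl_Ioo (hp : p ∈ Ioo a b) (hq : q ∈ Ioo a b) :
    ∃ g : HplusAC, g.1 p = q ∧ EqOn g.1 id (Ioo a b)ᶜ := by
  have hap : (0 : ℝ) < p - a := sub_pos.2 hp.1
  have hpb : (0 : ℝ) < b - p := sub_pos.2 hp.2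
  have haq : (a : ℝ) < q := hq.1
  have hqb : (q : ℝ) < b := hq.2
  obtain ⟨g, hg⟩ := exists_add_ramps hp.1 hp.2 (c := (q - p) / (p - a)) (d := (p - q) / (b - p))
    (by rw [lt_div_iff₀ hap]; linarith) (by rw [lt_div_iff₀ hpb]; linarith)
    (by rw [mul_div_cancel₀ _ hap.ne', mul_div_cancel₀ _ hpb.ne']; ring)
  refine ⟨g, Subtype.ext ?_, fun x hx => Subtype.ext ?_⟩
  · rw [hg, min_self, min_eq_right (by linarith), max_eq_left hap.le, sub_self, max_self,
      mul_div_cancel₀ _ hap.ne']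
    ring
  rcases le_or_gt x a with hxa | hax
  · have hxa' : (x : ℝ) ≤ a := hxa
    rw [id, hg, max_eq_right (by linarith [min_le_right (p : ℝ) x]),
      max_eq_right (by linarith [min_le_right (b : ℝ) x])]
    ring
  · have hbx : (b : ℝ) ≤ x := not_lt.1 fun hxb => hx ⟨hax, hxb⟩
    rw [id, hg, min_eq_left (by linarith), min_eq_left hbx, max_eq_left hap.le,
      max_eq_left hpb.le, mul_div_cancel₀ _ hap.ne', mul_div_cancel₀ _ hpb.ne']
    ring

theorem exists_apply_eq_and_eqOn_compl_Ioo (f : HplusAC) (hx : x ∈ Ioo a b)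
    (hy : y ∈ Ioo (f.1 a) (f.1 b)) :
    ∃ g : HplusAC, g.1 x = y ∧ EqOn f.1 g.1 (Ioo a b)ᶜ := by
  obtain ⟨φ, hφ, hφ_id⟩ :=
    exists_apply_eq_and_eqOn_id_compl_Ioo ⟨f.1.strictMono hx.1, f.1.strictMono hx.2⟩ hy
  refine ⟨φ * f, hφ, fun v hv => (hφ_id fun hfv => hv ?_).symm⟩
  exact ⟨f.1.lt_iff_lt.1 hfv.1, f.1.lt_iff_lt.1 hfv.2⟩

theorem isOpen_setOf_alternatesOn (B : Set unitInterval) :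
    IsOpen {f : HplusAC | f.1.AlternatesOn B} := by
  have heval (x : unitInterval) : Continuous fun f : HplusAC => f.1 x :=
    continuous_eval.comp (Continuous.prodMk_left x)
  refine isOpen_iff_mem_nhds.2 ?_
  rintro f ⟨x₁, hx₁, x₂, hx₂, x₃, hx₃, h₁₂, h₂₃, hpos₁, hneg₂, hpos₃⟩
  filter_upwards [(heval x₁).continuousAt (lt_mem_nhds hpos₁),
    (heval x₂).continuousAt (gt_mem_nhds hneg₂),
    (heval x₃).continuousAt (lt_mem_nhds hpos₃)] with g hg₁ hg₂ hg₃
  exact ⟨x₁, hx₁, x₂, hx₂, x₃, hx₃, h₁₂, h₂₃, hg₁, hg₂, hg₃⟩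

theorem exists_apply_eq₃_and_eqOn_compl_Ioo (f : HplusAC)
    {x₁ x₂ x₃ y₁ y₂ y₃ : unitInterval} (hx₁ : a < x₁) (hx₁₂ : x₁ < x₂) (hx₂₃ : x₂ < x₃)
    (hx₃ : x₃ < b) (hy₁ : f.1 a < y₁) (hy₁₂ : y₁ < y₂) (hy₂₃ : y₂ < y₃) (hy₃ : y₃ < f.1 b) :
    ∃ g : HplusAC, (g.1 x₁ = y₁ ∧ g.1 x₂ = y₂ ∧ g.1 x₃ = y₃) ∧ EqOn f.1 g.1 (Ioo a b)ᶜ := by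
  have hx₂ := hx₂₃.trans hx₃
  obtain ⟨g₁, hg₁x, hg₁⟩ := exists_apply_eq_and_eqOn_compl_Ioo f ⟨hx₁, hx₁₂.trans hx₂⟩
    ⟨hy₁, hy₁₂.trans (hy₂₃.trans hy₃)⟩
  have hg₁b : f.1 b = g₁.1 b := hg₁ fun h => h.2.false
  obtain ⟨g₂, hg₂x, hg₂⟩ := exists_apply_eq_and_eqOn_compl_Ioo g₁ ⟨hx₁₂, hx₂⟩
    ⟨hg₁x.trans_lt hy₁₂, (hy₂₃.trans hy₃).trans_eq hg₁b⟩
  have hg₂b : g₁.1 b = g₂.1 b := hg₂ fun h => h.2.false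
  obtain ⟨g₃, hg₃x, hg₃⟩ := exists_apply_eq_and_eqOn_compl_Ioo g₂ ⟨hx₂₃, hx₃⟩
    ⟨hg₂x.trans_lt hy₂₃, hy₃.trans_eq (hg₁b.trans hg₂b)⟩
  refine ⟨g₃, ⟨?_, ?_, hg₃x⟩, hg₁.trans ((hg₂.mono ?_).trans (hg₃.mono ?_))⟩
  · rw [← hg₃ fun h => h.1.not_gt hx₁₂, ← hg₂ fun h => h.1.false, hg₁x]
  · rw [← hg₃ fun h => h.1.false, hg₂x]
  · exact compl_subset_compl.2 (Ioo_subset_Ioo_left hx₁.le)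
  · exact compl_subset_compl.2 (Ioo_subset_Ioo_left (hx₁.trans hx₁₂).le)

theorem exists_alternatesOn_Icc {f : HplusAC} (hab : a < b) (hz : f.1 z = z)
    (hz_mem : z ∈ Icc a b) :
    ∃ g : HplusAC, g.1.AlternatesOn (Icc a b) ∧ dist f g ≤ 2 * (f.1 b - f.1 a) := by
  have hlt : max a (f.1 a) < min b (f.1 b) := by
    rcases hz_mem.1.eq_or_lt with rfl | haz
    · rw [hz, max_self]
      exact lt_min hab (hz.symm.trans_lt (f.1.strictMono hab))
    · exact (max_lt haz ((f.1.strictMono haz).trans_eq hz)).trans_le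
        (le_min hz_mem.2 (hz.symm.trans_le (f.1.monotone hz_mem.2)))
  obtain ⟨x₁, hx₁, hx₁'⟩ := exists_between hlt
  obtain ⟨y₁, hxy₁, hy₁'⟩ := exists_between hx₁'
  obtain ⟨y₂, hy₁₂, hy₂'⟩ := exists_between hy₁'
  obtain ⟨x₂, hyx₂, hx₂'⟩ := exists_between hy₂'
  obtain ⟨x₃, hx₂₃, hx₃'⟩ := exists_between hx₂'
  obtain ⟨y₃, hxy₃, hy₃'⟩ := exists_between hx₃'
  rw [max_lt_iff] at hx₁
  rw [lt_min_iff] at hx₃' hy₃'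
  have hx₁₂ := hxy₁.trans (hy₁₂.trans hyx₂)
  obtain ⟨g, ⟨hg₁, hg₂, hg₃⟩, hfg⟩ := exists_apply_eq₃_and_eqOn_compl_Ioo f hx₁.1 hx₁₂ hx₂₃
    hx₃'.1 (hx₁.2.trans hxy₁) hy₁₂ (hyx₂.trans (hx₂₃.trans hxy₃)) hy₃'.2
  have hx₂ := hx₁.1.trans hx₁₂
  exact ⟨g, ⟨x₁, ⟨hx₁.1.le, (hx₁₂.trans (hx₂₃.trans hx₃'.1)).le⟩,
    x₂, ⟨hx₂.le, (hx₂₃.trans hx₃'.1).le⟩, x₃, ⟨(hx₂.trans hx₂₃).le, hx₃'.1.le⟩, hx₁₂, hx₂₃,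
    hg₁ ▸ hxy₁, hg₂ ▸ hyx₂, hg₃ ▸ hxy₃⟩, dist_le_of_eqOn_compl_Ioo hab.le hfg⟩

theorem mem_closure_setOf_alternatesOn {f : HplusAC} (hz : f.1 z = z) (hB : B ∈ 𝓝 z) :
    f ∈ closure {g : HplusAC | g.1.AlternatesOn B} := by
  refine Metric.mem_closure_iff.2 fun ε hε => ?_
  have hsmall : f.1 ⁻¹' Metric.ball z (ε / 4) ∈ 𝓝 z :=
    f.1.continuous.continuousAt (by rw [hz]; exact Metric.ball_mem_nhds _ (by positivity))
  obtain ⟨a, b, hz_mem, hnhds, hsub⟩ := exists_Icc_mem_subset_of_mem_nhds (inter_mem hB hsmall)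
  have hle := hz_mem.1.trans hz_mem.2
  have hab : a < b := hle.lt_of_ne fun h =>
    infinite_of_mem_nhds z hnhds (by rw [h, Icc_self]; exact finite_singleton b)
  obtain ⟨g, hg, hdist⟩ := exists_alternatesOn_Icc hab hz hz_mem
  refine ⟨g, hg.mono fun x hx => (hsub hx).1, hdist.trans_lt ?_⟩
  have hfa : |(f.1 a : ℝ) - z| < ε / 4 := (hsub (left_mem_Icc.2 hle)).2
  have hfb : |(f.1 b : ℝ) - z| < ε / 4 := (hsub (right_mem_Icc.2 hle)).2
  linarith [(abs_lt.1 hfa).1, (abs_lt.1 hfb).2]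

theorem setOf_isAlternating_eq_biInter :
    {f : HplusAC | f.1.IsAlternating} = ⋂ B ∈ TopologicalSpace.countableBasis unitInterval,
      ({f | f.1.AlternatesOn B} ∪ {f | Disjoint f.1.Fix B}) := by
  have hbasis := TopologicalSpace.isBasis_countableBasis unitInterval
  ext f
  simp only [mem_iInter₂]
  refine ⟨fun hf B hB => or_iff_not_imp_right.2 fun hmeet => ?_, fun hf z hz U hU => ?_⟩
  · obtain ⟨z, hz, hzB⟩ := not_disjoint_iff.1 hmeet
    exact hf z hz B ((hbasis.isOpen hB).mem_nhds hzB)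
  · obtain ⟨B, hB, hzB, hBU⟩ := hbasis.mem_nhds_iff.1 hU
    rcases hf B hB with halt | hdisj
    exacts [halt.mono hBU, (Set.disjoint_left.1 hdisj hz hzB).elim]

theorem isGδ_setOf_alternatesOn_union_disjoint_Fix (hB : IsOpen B) :
    IsGδ ({f : HplusAC | f.1.AlternatesOn B} ∪ {f | Disjoint f.1.Fix B}) :=
  (isOpen_setOf_alternatesOn B).isGδ.union (isGδ_setOf_disjoint_Fix hB)

theorem dense_setOf_alternatesOn_union_disjoint_Fix (hB : IsOpen B) :
    Dense ({f : HplusAC | f.1.AlternatesOn B} ∪ {f | Disjoint f.1.Fix B}) := by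
  intro f
  by_cases hdisj : Disjoint f.1.Fix B
  · exact subset_closure (Or.inr hdisj)
  · obtain ⟨z, hz, hzB⟩ := not_disjoint_iff.1 hdisj
    exact closure_mono subset_union_left
      (mem_closure_setOf_alternatesOn hz (hB.mem_nhds hzB))

theorem isGδ_setOf_isAlternating : IsGδ {f : HplusAC | f.1.IsAlternating} := by
  rw [setOf_isAlternating_eq_biInter]
  exact .biInter (TopologicalSpace.countable_countableBasis unitInterval) fun B hB =>
    isGδ_setOf_alternatesOn_union_disjoint_Fix (TopologicalSpace.isOpen_of_mem_countableBasis hB)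

theorem dense_setOf_isAlternating : Dense {f : HplusAC | f.1.IsAlternating} := by
  rw [setOf_isAlternating_eq_biInter]
  refine dense_biInter_of_Gδ (fun B hB => ?_)
    (TopologicalSpace.countable_countableBasis unitInterval) fun B hB => ?_
  · exact isGδ_setOf_alternatesOn_union_disjoint_Fix
      (TopologicalSpace.isOpen_of_mem_countableBasis hB)
  · exact dense_setOf_alternatesOn_union_disjoint_Fix
      (TopologicalSpace.isOpen_of_mem_countableBasis hB)

theorem setCN_eq :
    setCN = {f : HplusAC | f.1.IsAlternating} ∩ {f : HplusAC | volume f.1.Fix = 0} :=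
  ext fun _ => Hplus.mem_setC_inter_setN_iff_isAlternating

theorem isGδ_setCN : IsGδ setCN :=
  setCN_eq ▸ isGδ_setOf_isAlternating.inter isGδ_setOf_volume_Fix_eq_zero

theorem dense_setCN : Dense setCN :=
  setCN_eq ▸ dense_setOf_isAlternating.inter_of_Gδ isGδ_setOf_isAlternating
    isGδ_setOf_volume_Fix_eq_zero dense_setOf_volume_Fix_eq_zero

end HplusAC

/-! ### Coloured dense linear orders -/

section ColoredOrder

variable {α β C : Type*}

/-- Every colour of the colouring `a` is taken in every nonempty open interval between two points.
This is the hypothesis of the back-and-forth argument for coloured orders. -/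
def IsColorDense [LT α] (a : α → C) : Prop :=
  ∀ ⦃x y⦄, x < y → ∀ c, ∃ z, x < z ∧ z < y ∧ a z = c

theorem IsColorDense.denselyOrdered [LT α] {a : α → C} (ha : IsColorDense a) : DenselyOrdered α :=
  ⟨fun x _ hxy => (ha hxy (a x)).imp fun _ hz => ⟨hz.1, hz.2.1⟩⟩

variable [LinearOrder α] [LinearOrder β]

theorem IsColorDense.exists_between_finsets [NoMinOrder α] [NoMaxOrder α] [Nonempty α]
    {a : α → C} (ha : IsColorDense a) (c : C) (lo hi : Finset α)
    (h : ∀ x ∈ lo, ∀ y ∈ hi, x < y) :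
    ∃ m, a m = c ∧ (∀ x ∈ lo, x < m) ∧ ∀ y ∈ hi, m < y := by
  classical
  have := ha.denselyOrdered
  obtain ⟨m, hlo_m, hm_hi⟩ := Order.exists_between_finsets lo hi h
  obtain ⟨n, hlo_n, hn_hi⟩ := Order.exists_between_finsets (insert m lo) hi
    (Finset.forall_mem_insert _ _ _ |>.2 ⟨hm_hi, h⟩)
  obtain ⟨z, hmz, hzn, hz⟩ := ha (hlo_n m (Finset.mem_insert_self _ _)) c
  exact ⟨z, hz, fun x hx => (hlo_m x hx).trans hmz, fun y hy => hzn.trans (hn_hi y hy)⟩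

/-- Finite partial order isomorphisms that preserve given colourings, the approximations of the
back-and-forth argument. -/
abbrev ColoredPartialIso (a : α → C) (b : β → C) : Type _ :=
  {f : Order.PartialIso α β // ∀ p ∈ f.val, a p.1 = b p.2}

namespace ColoredPartialIso

variable {a : α → C} {b : β → C}

theorem exists_across [NoMinOrder β] [NoMaxOrder β] [Nonempty β] (hb : IsColorDense b)
    (f : ColoredPartialIso a b) (x : α) :
    ∃ y : β, a x = b y ∧ ∀ p ∈ f.1.val, cmp p.1 x = cmp p.2 y := by
  classical
  by_cases h : ∃ y, (x, y) ∈ f.1.val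
  · obtain ⟨y, hy⟩ := h
    exact ⟨y, f.2 _ hy, fun p hp => f.1.prop _ hp _ hy⟩
  obtain ⟨y, hy, hlo, hhi⟩ := hb.exists_between_finsets (a x)
    ({p ∈ f.1.val | p.1 < x}.image Prod.snd) ({p ∈ f.1.val | x < p.1}.image Prod.snd) (by
      simp only [Finset.forall_mem_image, Finset.mem_filter]
      exact fun p hp q hq =>
        (lt_iff_lt_of_cmp_eq_cmp (f.1.prop _ hp.1 _ hq.1)).1 (hp.2.trans hq.2))
  refine ⟨y, hy.symm, fun p hp => ?_⟩
  have hne : p.1 ≠ x := fun hpx => h ⟨p.2, hpx ▸ hp⟩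
  rcases lt_or_gt_of_ne hne with hlt | hgt
  · rw [(cmp_eq_lt_iff _ _).2 hlt, (cmp_eq_lt_iff _ _).2
      (hlo _ (Finset.mem_image.2 ⟨p, Finset.mem_filter.2 ⟨hp, hlt⟩, rfl⟩))]
  · rw [(cmp_eq_gt_iff _ _).2 hgt, (cmp_eq_gt_iff _ _).2
      (hhi _ (Finset.mem_image.2 ⟨p, Finset.mem_filter.2 ⟨hp, hgt⟩, rfl⟩))]

/-- The inverse of a coloured partial isomorphism, which exchanges the two directions of the
back-and-forth argument. -/
def comm (f : ColoredPartialIso a b) : ColoredPartialIso b a :=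
  ⟨f.1.comm, fun p hp => by
    classical
    obtain ⟨q, hq, rfl⟩ := Finset.mem_image.1 (show p ∈ f.1.val.image (Equiv.prodComm α β) from hp)
    exact (f.2 q hq).symm⟩

theorem mem_comm {f : ColoredPartialIso a b} {p : β × α} :
    p ∈ f.comm.1.val ↔ p.swap ∈ f.1.val := by
  classical
  change p ∈ f.1.val.image (Equiv.prodComm α β) ↔ _
  rw [Finset.mem_image]
  exact ⟨by rintro ⟨q, hq, rfl⟩; exact hq, fun hp => ⟨p.swap, hp, rfl⟩⟩

/-- The cofinal set of coloured partial isomorphisms that are defined at `x`. -/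
def definedAtLeft [NoMinOrder β] [NoMaxOrder β] [Nonempty β] (a : α → C) (hb : IsColorDense b)
    (x : α) : Order.Cofinal (ColoredPartialIso a b) where
  carrier := {f | ∃ y : β, (x, y) ∈ f.1.val}
  isCofinal f := by
    classical
    obtain ⟨y, hxy, h⟩ := exists_across hb f x
    refine ⟨⟨⟨insert (x, y) f.1.val, fun p hp q hq => ?_⟩, fun p hp => ?_⟩,
      ⟨y, Finset.mem_insert_self _ _⟩, Finset.subset_insert _ _⟩
    · rw [Finset.mem_insert] at hp hq
      rcases hp with rfl | hp <;> rcases hq with rfl | hq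
      · simp only [cmp_self_eq_eq]
      · rw [cmp_eq_cmp_symm]
        exact h _ hq
      · exact h _ hp
      · exact f.1.prop _ hp _ hq
    · rcases Finset.mem_insert.1 hp with rfl | hp
      exacts [hxy, f.2 p hp]

/-- The cofinal set of coloured partial isomorphisms that have `y` in their image. -/
def definedAtRight [NoMinOrder α] [NoMaxOrder α] [Nonempty α] (ha : IsColorDense a) (b : β → C)
    (y : β) : Order.Cofinal (ColoredPartialIso a b) where
  carrier := {f | ∃ x : α, (x, y) ∈ f.1.val}
  isCofinal f := by
    obtain ⟨g, ⟨x, hx⟩, hg⟩ := (definedAtLeft b ha y).isCofinal f.comm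
    exact ⟨g.comm, ⟨x, mem_comm.2 hx⟩, fun p hp => mem_comm.2 (hg (mem_comm.2 hp))⟩

end ColoredPartialIso

theorem exists_orderIso_of_isColorDense [Countable α] [NoMinOrder α] [NoMaxOrder α] [Nonempty α]
    [Countable β] [NoMinOrder β] [NoMaxOrder β] [Nonempty β] {a : α → C} {b : β → C}
    (ha : IsColorDense a) (hb : IsColorDense b) : ∃ e : α ≃o β, ∀ x, b (e x) = a x := by
  cases nonempty_encodable α
  cases nonempty_encodable β
  let D : α ⊕ β → Order.Cofinal (ColoredPartialIso a b) :=
    Sum.elim (ColoredPartialIso.definedAtLeft a hb) (ColoredPartialIso.definedAtRight ha b)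
  let I : Order.Ideal (ColoredPartialIso a b) := Order.idealOfCofinals
    ⟨default, fun p hp => absurd hp (Finset.notMem_empty p)⟩ D
  have hleft (x : α) : ∃ y, ∃ f ∈ I, (x, y) ∈ f.1.val := by
    obtain ⟨f, ⟨y, hy⟩, hf⟩ := Order.cofinal_meets_idealOfCofinals _ D (Sum.inl x)
    exact ⟨y, f, hf, hy⟩
  have hright (y : β) : ∃ x, ∃ f ∈ I, (x, y) ∈ f.1.val := by
    obtain ⟨f, ⟨x, hx⟩, hf⟩ := Order.cofinal_meets_idealOfCofinals _ D (Sum.inr y)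
    exact ⟨x, f, hf, hx⟩
  choose u f hf hu using hleft
  choose v g hg hv using hright
  refine ⟨OrderIso.ofCmpEqCmp u v fun x y => ?_, fun x => ((f x).2 _ (hu x)).symm⟩
  obtain ⟨m, -, hfm, hgm⟩ := I.directed _ (hf x) _ (hg y)
  exact m.1.prop _ (hfm (hu x)) _ (hgm (hv y))

end ColoredOrder

section DenseFamilies

variable {ι α β : Type*} [LinearOrder α] [TopologicalSpace α] [OrderTopology α] [DenselyOrdered α]
  {p : ι → α} {q : ι → β}

theorem exists_strictMono_of_denseRange [CompleteLinearOrder β] (hp : DenseRange p)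
    (hpq : ∀ i j, p i < p j ↔ q i < q j) : ∃ u : α → β, StrictMono u ∧ ∀ i, u (p i) = q i := by
  refine ⟨fun x => sSup (q '' {i | p i ≤ x}), fun x y hxy => ?_, fun i => ?_⟩
  · obtain ⟨m, hxm, hmy⟩ := exists_between hxy
    obtain ⟨_, ⟨i, rfl⟩, hxi, him⟩ := hp.exists_between hxm
    obtain ⟨_, ⟨j, rfl⟩, hmj, hjy⟩ := hp.exists_between hmy
    calc sSup (q '' {i | p i ≤ x}) ≤ q i :=
          sSup_le (forall_mem_image.2 fun k hk => ((hpq k i).1 (lt_of_le_of_lt hk hxi)).le)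
      _ < q j := (hpq i j).1 (him.trans hmj)
      _ ≤ sSup (q '' {i | p i ≤ y}) := le_sSup ⟨j, hjy.le, rfl⟩
  · refine le_antisymm (sSup_le (forall_mem_image.2 fun k hk => ?_)) (le_sSup ⟨i, le_rfl, rfl⟩)
    exact le_of_not_gt fun hlt => not_le.2 ((hpq i k).2 hlt) hk

theorem eq_id_of_monotone_of_denseRange {w : α → α} (hw : Monotone w) (hp : DenseRange p)
    (hwp : ∀ i, w (p i) = p i) : w = id := by
  have hdense : DenseRange w := hp.mono (range_subset_iff.2 fun i => ⟨p i, hwp i⟩)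
  exact Continuous.ext_on hp (hw.continuous_of_denseRange hdense) continuous_id
    (forall_mem_range.2 hwp)

end DenseFamilies

theorem exists_orderIso_of_denseRange {ι α β : Type*} [CompleteLinearOrder α] [TopologicalSpace α]
    [OrderTopology α] [DenselyOrdered α] [CompleteLinearOrder β] [TopologicalSpace β]
    [OrderTopology β] [DenselyOrdered β] {p : ι → α} {q : ι → β} (hp : DenseRange p)
    (hq : DenseRange q) (hpq : ∀ i j, p i < p j ↔ q i < q j) :
    ∃ e : α ≃o β, ∀ i, e (p i) = q i := by
  obtain ⟨u, hu, hup⟩ := exists_strictMono_of_denseRange hp hpq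
  obtain ⟨v, hv, hvq⟩ := exists_strictMono_of_denseRange hq fun i j => (hpq i j).symm
  have huv : u ∘ v = id := eq_id_of_monotone_of_denseRange (hu.comp hv).monotone hq fun i => by
    rw [Function.comp_apply, hvq, hup]
  exact ⟨hu.orderIsoOfSurjective u fun y => ⟨v y, congrFun huv y⟩, hup⟩

/-! ### Linearization on an orbital -/

namespace Hplus

variable {f : Hplus} {a b s x y : unitInterval} {u t : ℝ}

theorem zpow_apply_of_fixed (hx : f x = x) (n : ℤ) : (f ^ n) x = x :=
  zpow_mem (show f ∈ MulAction.stabilizer Hplus x from hx) n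

theorem strictMono_zpow_apply (hs : s < f s) : StrictMono fun n : ℤ => (f ^ n) s := by
  refine strictMono_int_of_lt_succ fun n => ?_
  rw [zpow_add_one, RelIso.mul_apply]
  exact (f ^ n).strictMono hs

theorem map_iSup_zpow (f : Hplus) (s : unitInterval) :
    f (⨆ n : ℤ, (f ^ n) s) = ⨆ n : ℤ, (f ^ n) s := by
  rw [f.map_iSup, ← (Equiv.addLeft (1 : ℤ)).iSup_comp (g := fun n : ℤ => (f ^ n) s)]
  simp only [Equiv.coe_addLeft, zpow_one_add, RelIso.mul_apply]

theorem map_iInf_zpow (f : Hplus) (s : unitInterval) :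
    f (⨅ n : ℤ, (f ^ n) s) = ⨅ n : ℤ, (f ^ n) s := by
  rw [f.map_iInf, ← (Equiv.addLeft (1 : ℤ)).iInf_comp (g := fun n : ℤ => (f ^ n) s)]
  simp only [Equiv.coe_addLeft, zpow_one_add, RelIso.mul_apply]

theorem IsGap.exists_zpow_le_lt (h : f.IsGap a b) (hs : s ∈ Ioo a b) (hfs : s < f s)
    (hx : x ∈ Ioo a b) : ∃ n : ℤ, (f ^ n) s ≤ x ∧ x < (f ^ (n + 1)) s := by
  have hmono := strictMono_zpow_apply hfs
  have hle : ∃ n : ℤ, (f ^ n) s ≤ x := by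
    by_contra! hlt
    exact h.ne _ ⟨hx.1.trans_le (le_iInf fun n => (hlt n).le),
      (iInf_le (fun n : ℤ => (f ^ n) s) 0).trans_lt hs.2⟩ (f.map_iInf_zpow s)
  have hlt : ∃ n : ℤ, x < (f ^ n) s := by
    by_contra! hle
    exact h.ne _ ⟨hs.1.trans_le (le_iSup (fun n : ℤ => (f ^ n) s) 0),
      (iSup_le hle).trans_lt hx.2⟩ (f.map_iSup_zpow s)
  obtain ⟨m, hm⟩ := hlt
  obtain ⟨n, hn, hmax⟩ := Int.exists_greatest_of_bdd (P := fun n : ℤ => (f ^ n) s ≤ x)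
    ⟨m, fun n hn => (hmono.lt_iff_lt.1 (hn.trans_lt hm)).le⟩ hle
  exact ⟨n, hn, lt_of_not_ge fun hle => (Int.lt_succ n).not_ge (hmax _ hle)⟩

/-- The affine parametrization of the interval from `s` to `f s` by `[0, 1]`. The projection onto
`[0, 1]` only matters for parameters outside `[0, 1]`. -/
noncomputable def arc (f : Hplus) (s : unitInterval) (t : ℝ) : unitInterval :=
  projIcc 0 1 zero_le_one (AffineMap.lineMap (s : ℝ) (f s : ℝ) t)

theorem coe_arc (ht : t ∈ Icc (0 : ℝ) 1) : (f.arc s t : ℝ) = AffineMap.lineMap (s : ℝ) (f s) t :=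
  congrArg Subtype.val
    (projIcc_of_mem zero_le_one ((convex_Icc 0 1).lineMap_mem s.2 (f s).2 ht))

theorem arc_zero : f.arc s 0 = s :=
  Subtype.ext (by rw [coe_arc (left_mem_Icc.2 zero_le_one), AffineMap.lineMap_apply_zero])

theorem arc_one : f.arc s 1 = f s :=
  Subtype.ext (by rw [coe_arc (right_mem_Icc.2 zero_le_one), AffineMap.lineMap_apply_one])

theorem strictMonoOn_arc (hs : s < f s) : StrictMonoOn (f.arc s) (Icc 0 1) := by
  intro t ht t' ht' htt'
  rw [← Subtype.coe_lt_coe, coe_arc ht, coe_arc ht']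
  exact (lineMap_lt_lineMap_iff_of_lt htt').2 hs

theorem exists_arc_eq (hy : y ∈ Ico s (f s)) : ∃ t ∈ Ico (0 : ℝ) 1, f.arc s t = y := by
  have hd : (0 : ℝ) < f s - s :=
    sub_pos.2 (Subtype.coe_lt_coe.2 (hy.1.trans_lt hy.2))
  have hys : (y : ℝ) < f s := hy.2
  have ht : ((y : ℝ) - s) / (f s - s) ∈ Ico (0 : ℝ) 1 :=
    ⟨div_nonneg (sub_nonneg.2 hy.1) hd.le, (div_lt_one hd).2 (sub_lt_sub_right hys _)⟩
  refine ⟨_, ht, Subtype.ext ?_⟩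
  rw [coe_arc (Ico_subset_Icc_self ht), AffineMap.lineMap_apply_ring']
  field_simp
  ring

/-- The parametrization by `ℝ` of the orbital of `s` that is affine from `[0, 1)` onto the
fundamental domain `[s, f s)` and conjugates the translation by `1` to `f`. -/
noncomputable def parametrization (f : Hplus) (s : unitInterval) (u : ℝ) : unitInterval :=
  (f ^ ⌊u⌋) (f.arc s (Int.fract u))

theorem parametrization_add_one : f.parametrization s (u + 1) = f (f.parametrization s u) := by
  rw [parametrization, Int.floor_add_one, Int.fract_add_one, add_comm, zpow_one_add,
    RelIso.mul_apply, parametrization]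

theorem parametrization_intCast_add (ht : t ∈ Ico (0 : ℝ) 1) (n : ℤ) :
    f.parametrization s (n + t) = (f ^ n) (f.arc s t) := by
  rw [parametrization, Int.floor_intCast_add, Int.fract_intCast_add, Int.fract_eq_self.2 ht,
    Int.floor_eq_zero_iff.2 ht, add_zero]

theorem fract_mem_Icc (u : ℝ) : Int.fract u ∈ Icc (0 : ℝ) 1 :=
  ⟨Int.fract_nonneg u, (Int.fract_lt_one u).le⟩

theorem parametrization_mem_Ico (hs : s < f s) (u : ℝ) :
    f.parametrization s u ∈ Ico ((f ^ ⌊u⌋) s) ((f ^ (⌊u⌋ + 1)) s) := by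
  have hmono := strictMonoOn_arc hs
  constructor
  · refine (f ^ ⌊u⌋).monotone ?_
    simpa only [arc_zero] using
      hmono.monotoneOn (left_mem_Icc.2 zero_le_one) (fract_mem_Icc u) (Int.fract_nonneg u)
  · rw [zpow_add_one, RelIso.mul_apply]
    refine (f ^ ⌊u⌋).strictMono ?_
    simpa only [arc_one] using
      hmono (fract_mem_Icc u) (right_mem_Icc.2 zero_le_one) (Int.fract_lt_one u)

theorem strictMono_parametrization (hs : s < f s) : StrictMono (f.parametrization s) := by
  intro u v huv
  rcases (Int.floor_mono huv.le).eq_or_lt with heq | hlt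
  · rw [parametrization, parametrization, heq]
    refine (f ^ ⌊v⌋).strictMono (strictMonoOn_arc hs (fract_mem_Icc u) (fract_mem_Icc v) ?_)
    rw [Int.fract, Int.fract, heq]
    exact sub_lt_sub_right huv _
  · exact (parametrization_mem_Ico hs u).2.trans_le <|
      ((strictMono_zpow_apply hs).monotone (Int.add_one_le_iff.2 hlt)).trans
        (parametrization_mem_Ico hs v).1

theorem range_parametrization (hs : s < f s) : range (f.parametrization s) = f.orbital s := by
  obtain ⟨a, b, hab, hs_mem⟩ := exists_isGap hs.ne'
  have hzpow_mem (n : ℤ) : (f ^ n) s ∈ Ioo a b := by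
    constructor
    · simpa only [zpow_apply_of_fixed hab.left] using (f ^ n).strictMono hs_mem.1
    · simpa only [zpow_apply_of_fixed hab.right] using (f ^ n).strictMono hs_mem.2
  rw [hab.orbital_eq hs_mem]
  refine Subset.antisymm (range_subset_iff.2 fun u => ?_) fun x hx => ?_
  · have hu := parametrization_mem_Ico hs u
    exact ⟨(hzpow_mem _).1.trans_le hu.1, hu.2.trans (hzpow_mem _).2⟩
  · obtain ⟨n, hle, hlt⟩ := hab.exists_zpow_le_lt hs_mem hs hx
    obtain ⟨y, rfl⟩ := (f ^ n).surjective x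
    rw [zpow_add_one, RelIso.mul_apply, OrderIso.lt_iff_lt] at hlt
    obtain ⟨t, ht, rfl⟩ := exists_arc_eq ⟨(f ^ n).le_iff_le.1 hle, hlt⟩
    exact ⟨n + t, parametrization_intCast_add ht n⟩

theorem volume_image_parametrization_eq_zero (hf : f ∈ HplusAC) {E : Set ℝ} (hE : volume E = 0) :
    volume (f.parametrization s '' E) = 0 := by
  have hsub : f.parametrization s '' E ⊆ ⋃ n : ℤ, (f ^ n) ''
      (Subtype.val ⁻¹' ((fun u : ℝ => AffineMap.lineMap (s : ℝ) (f s : ℝ) (u - n)) '' E)) := by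
    rintro _ ⟨u, hu, rfl⟩
    exact mem_iUnion.2 ⟨⌊u⌋, _, ⟨u, hu, (coe_arc (fract_mem_Icc u)).symm⟩, rfl⟩
  refine measure_mono_null hsub (measure_iUnion_null fun n => ?_)
  refine (mem_HplusAC_iff.1 (zpow_mem hf n)).1 _ ?_
  rw [unitInterval.volume_apply]
  refine measure_mono_null (image_preimage_subset _ _)
    (addHaar_image_eq_zero_of_differentiableOn_of_addHaar_eq_zero _ ?_ hE)
  simp only [AffineMap.lineMap_apply_ring']
  fun_prop

theorem volume_preimage_parametrization_eq_zero (hf : f ∈ HplusAC) (hs : s < f s)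
    {E : Set unitInterval} (hE : volume E = 0) : volume (f.parametrization s ⁻¹' E) = 0 := by
  have hd : (f s : ℝ) - s ≠ 0 := (sub_pos.2 (Subtype.coe_lt_coe.2 hs)).ne'
  have hsub : f.parametrization s ⁻¹' E ⊆ ⋃ n : ℤ, (fun y : ℝ => (y - s) / (f s - s) + n) ''
      (Subtype.val '' ((f ^ n).symm '' E)) := by
    intro u hu
    refine mem_iUnion.2 ⟨⌊u⌋, _, ⟨_, ⟨_, hu, rfl⟩, rfl⟩, ?_⟩
    change ((((f ^ ⌊u⌋).symm (f.parametrization s u) : unitInterval) : ℝ) - s) / (f s - s) + ⌊u⌋ = u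
    rw [parametrization, OrderIso.symm_apply_apply, coe_arc (fract_mem_Icc u),
      AffineMap.lineMap_apply_ring', add_sub_cancel_right, mul_div_cancel_right₀ _ hd,
      Int.fract_add_floor]
  refine measure_mono_null hsub (measure_iUnion_null fun n =>
    addHaar_image_eq_zero_of_differentiableOn_of_addHaar_eq_zero _ (by fun_prop) ?_)
  rw [← unitInterval.volume_apply]
  exact (mem_HplusAC_iff.1 (zpow_mem hf n)).2 _ hE

/-- `θ` is an increasing parametrization of `J` by `ℝ` that conjugates the translation by `d` to `f`
and along which null sets correspond to null sets. Conjugacies between elements of `HplusAC` are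
glued from such parametrizations. -/
structure IsLinearization (f : Hplus) (J : Set unitInterval) (d : ℝ) (θ : ℝ → unitInterval) :
    Prop where
  strictMono : StrictMono θ
  range_eq : range θ = J
  apply_add : ∀ u, θ (u + d) = f (θ u)
  image_null : ∀ E, volume E = 0 → volume (θ '' E) = 0
  preimage_null : ∀ E, volume E = 0 → volume (θ ⁻¹' E) = 0

theorem isLinearization_parametrization (hf : f ∈ HplusAC) (hs : s < f s) :
    f.IsLinearization (f.orbital s) 1 (f.parametrization s) where
  strictMono := strictMono_parametrization hs
  range_eq := range_parametrization hs
  apply_add _ := parametrization_add_one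
  image_null _ := volume_image_parametrization_eq_zero hf
  preimage_null _ := volume_preimage_parametrization_eq_zero hf hs

theorem IsLinearization.inv {J : Set unitInterval} {d : ℝ} {θ : ℝ → unitInterval}
    (h : f.IsLinearization J d θ) : f⁻¹.IsLinearization J (-d) θ where
  __ := h
  apply_add u := by
    have hu := h.apply_add (u + -d)
    rw [neg_add_cancel_right] at hu
    exact (f.symm_apply_eq.2 hu).symm

theorem Fix_inv (f : Hplus) : f⁻¹.Fix = f.Fix :=
  Set.ext fun _ => f.symm_apply_eq.trans eq_comm

theorem orbital_inv (f : Hplus) (x : unitInterval) : f⁻¹.orbital x = f.orbital x := by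
  rw [orbital, orbital, Fix_inv]

theorem exists_isLinearization_of_mem_positiveOrbitals (hf : f ∈ HplusAC) {J : Set unitInterval}
    (hJ : J ∈ f.positiveOrbitals) : ∃ θ, f.IsLinearization J 1 θ := by
  obtain ⟨s, hs, rfl⟩ := hJ
  exact ⟨_, isLinearization_parametrization hf hs⟩

theorem exists_isLinearization_of_mem_negativeOrbitals (hf : f ∈ HplusAC) {J : Set unitInterval}
    (hJ : J ∈ f.negativeOrbitals) : ∃ θ, f.IsLinearization J (-1) θ := by
  obtain ⟨s, hs, rfl⟩ := hJ
  have hs_inv : s < f⁻¹ s := f.lt_symm_apply.2 hs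
  refine ⟨f⁻¹.parametrization s, ?_⟩
  simpa only [inv_inv, orbital_inv] using
    (isLinearization_parametrization (inv_mem hf) hs_inv).inv

end Hplus

/-! ### Conjugacy -/

namespace Hplus

variable {f g h : Hplus}

/-- The orbitals of `f` of nonzero parity, ordered from left to right. A type synonym is needed
since the subtype `f.nonzeroOrbitals` is already ordered by inclusion. -/
def OrderedOrbital (f : Hplus) : Type := f.nonzeroOrbitals

namespace OrderedOrbital

open Classical in
noncomputable instance : LinearOrder f.OrderedOrbital :=
  have : IsStrictTotalOrder f.OrderedOrbital fun J K => Precedes J.1 K.1 :=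
    f.isStrictTotalOrder_precedes
  linearOrderOfSTO fun J K => Precedes J.1 K.1

instance : Countable f.OrderedOrbital := countable_nonzeroOrbitals.to_subtype

theorem nonempty (hf : f ∈ setC) : Nonempty f.OrderedOrbital := hf.1.to_subtype

theorem noMinOrder (hf : f ∈ setC) : NoMinOrder f.OrderedOrbital where
  exists_lt J :=
    let ⟨K, hK, hKJ⟩ := hf.2.2.2.1 J.1 J.2
    ⟨⟨K, hK⟩, hKJ⟩

theorem noMaxOrder (hf : f ∈ setC) : NoMaxOrder f.OrderedOrbital where
  exists_gt J :=
    let ⟨K, hK, hJK⟩ := hf.2.2.2.2.1 J.1 J.2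
    ⟨⟨K, hK⟩, hJK⟩

/-- The parity of an orbital, encoded as a colour: `True` is positive and `False` is negative. -/
def IsPositive (J : f.OrderedOrbital) : Prop := J.1 ∈ f.positiveOrbitals

theorem not_isPositive_iff {J : f.OrderedOrbital} : ¬J.IsPositive ↔ J.1 ∈ f.negativeOrbitals := by
  obtain ⟨x, hx⟩ := nonempty_of_mem_nonzeroOrbitals J.2
  rw [IsPositive, mem_positiveOrbitals_iff J.2 hx, mem_negativeOrbitals_iff J.2 hx, not_lt,
    (apply_ne_of_mem J.2 hx).le_iff_lt]

theorem isColorDense_isPositive (hf : f ∈ setC) :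
    IsColorDense (IsPositive : f.OrderedOrbital → Prop) := by
  obtain ⟨-, -, -, -, -, hpos, hneg⟩ := hf
  intro J K hJK c
  by_cases hc : c
  · obtain ⟨L, hL, hJL, hLK⟩ := hpos J.1 J.2 K.1 K.2 hJK
    exact ⟨⟨L, mem_nonzeroOrbitals_of_mem_positiveOrbitals hL⟩, hJL, hLK,
      propext (iff_of_true hL hc)⟩
  · obtain ⟨L, hL, hJL, hLK⟩ := hneg J.1 J.2 K.1 K.2 hJK
    exact ⟨⟨L, mem_nonzeroOrbitals_of_mem_negativeOrbitals hL⟩, hJL, hLK,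
      propext (iff_of_false (not_isPositive_iff.2 hL) hc)⟩

theorem exists_orderIso (hf : f ∈ setC) (hg : g ∈ setC) :
    ∃ e : f.OrderedOrbital ≃o g.OrderedOrbital, ∀ J, (e J).IsPositive = J.IsPositive := by
  have := nonempty hf
  have := noMinOrder hf
  have := noMaxOrder hf
  have := nonempty hg
  have := noMinOrder hg
  have := noMaxOrder hg
  exact exists_orderIso_of_isColorDense (isColorDense_isPositive hf) (isColorDense_isPositive hg)

open Classical in
/-- The length of the translation that models `f` on the orbital `J`. -/
noncomputable def shift (J : f.OrderedOrbital) : ℝ := if J.IsPositive then 1 else -1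

theorem exists_isLinearization (hf : f ∈ HplusAC) (J : f.OrderedOrbital) :
    ∃ θ, f.IsLinearization J.1 J.shift θ := by
  rw [shift]
  split_ifs with hJ
  · exact exists_isLinearization_of_mem_positiveOrbitals hf hJ
  · exact exists_isLinearization_of_mem_negativeOrbitals hf (not_isPositive_iff.1 hJ)

end OrderedOrbital

/-- A linearization of `f` on each of its orbitals of nonzero parity. -/
def IsLinearizationFamily (f : Hplus) (θ : f.OrderedOrbital → ℝ → unitInterval) : Prop :=
  ∀ J, f.IsLinearization J.1 J.shift (θ J)

theorem exists_isLinearizationFamily (hf : f ∈ HplusAC) : ∃ θ, f.IsLinearizationFamily θ :=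
  Classical.skolem.1 (OrderedOrbital.exists_isLinearization hf)

namespace IsLinearizationFamily

variable {θ : f.OrderedOrbital → ℝ → unitInterval} {η : g.OrderedOrbital → ℝ → unitInterval}
  {e : f.OrderedOrbital ≃o g.OrderedOrbital}

theorem apply_mem (hθ : f.IsLinearizationFamily θ) (J : f.OrderedOrbital) (u : ℝ) :
    θ J u ∈ J.1 := by
  have hu := mem_range_self (f := θ J) u
  rwa [(hθ J).range_eq] at hu

theorem exists_apply_eq (hθ : f.IsLinearizationFamily θ) {x : unitInterval} (hx : f x ≠ x) :
    ∃ J u, θ J u = x := by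
  let J : f.OrderedOrbital := ⟨_, orbital_mem_nonzeroOrbitals hx⟩
  have hmem : x ∈ range (θ J) := by
    rw [(hθ J).range_eq]
    exact mem_orbital hx
  exact ⟨J, hmem⟩

theorem denseRange (hθ : f.IsLinearizationFamily θ) (hnull : volume f.Fix = 0) :
    DenseRange fun i : f.OrderedOrbital × ℝ => θ i.1 i.2 := by
  refine dense_of_exists_between fun x y hxy => ?_
  obtain ⟨v, hv, hfv⟩ := exists_apply_ne_mem_Ioo hnull hxy
  obtain ⟨J, u, rfl⟩ := hθ.exists_apply_eq hfv
  exact ⟨_, ⟨(J, u), rfl⟩, hv⟩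

theorem lt_iff (hθ : f.IsLinearizationFamily θ) (J K : f.OrderedOrbital) (u v : ℝ) :
    θ J u < θ K v ↔ J < K ∨ J = K ∧ u < v := by
  have hlt {J K : f.OrderedOrbital} (hJK : J < K) (u v : ℝ) : θ J u < θ K v :=
    (show Precedes J.1 K.1 from hJK) _ (hθ.apply_mem J u) _ (hθ.apply_mem K v)
  rcases lt_trichotomy J K with hJK | rfl | hKJ
  · simp only [hlt hJK, hJK, true_or]
  · simp only [(hθ J).strictMono.lt_iff_lt, lt_irrefl, false_or, true_and]
  · simp only [(hlt hKJ v u).not_gt, hKJ.not_gt, hKJ.ne', false_and, or_false]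

theorem denseRange_comp (hη : g.IsLinearizationFamily η) (hnull : volume g.Fix = 0)
    (e : f.OrderedOrbital ≃o g.OrderedOrbital) :
    DenseRange fun i : f.OrderedOrbital × ℝ => η (e i.1) i.2 :=
  (hη.denseRange hnull).mono <| range_subset_iff.2 fun ⟨K, u⟩ =>
    ⟨(e.symm K, u), by simp only [OrderIso.apply_symm_apply]⟩

theorem exists_apply_eq_comp (hθ : f.IsLinearizationFamily θ) (hη : g.IsLinearizationFamily η)
    (hf_null : volume f.Fix = 0) (hg_null : volume g.Fix = 0)
    (e : f.OrderedOrbital ≃o g.OrderedOrbital) : ∃ h : Hplus, ∀ J u, h (θ J u) = η (e J) u := by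
  obtain ⟨h, hh⟩ := exists_orderIso_of_denseRange (hθ.denseRange hf_null)
    (hη.denseRange_comp hg_null e) fun i j => by
      rw [hθ.lt_iff, hη.lt_iff, e.lt_iff_lt, e.injective.eq_iff]
  exact ⟨h, fun J u => hh (J, u)⟩

theorem mul_eq_mul_of_apply_eq (hθ : f.IsLinearizationFamily θ) (hη : g.IsLinearizationFamily η)
    (hf_null : volume f.Fix = 0) (he : ∀ J, (e J).shift = J.shift)
    (hh : ∀ J u, h (θ J u) = η (e J) u) : h * f = g * h := by
  refine DFunLike.coe_injective (Continuous.ext_on (hθ.denseRange hf_null) (h * f).continuous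
    (g * h).continuous (forall_mem_range.2 fun ⟨J, u⟩ => ?_))
  simp only [RelIso.mul_apply]
  rw [← (hθ J).apply_add, hh, hh, ← he, (hη (e J)).apply_add]

theorem volume_image_eq_zero_of_apply_eq (hθ : f.IsLinearizationFamily θ)
    (hη : g.IsLinearizationFamily η) (hg_null : volume g.Fix = 0)
    (hh : ∀ J u, h (θ J u) = η (e J) u) {E : Set unitInterval} (hE : volume E = 0) :
    volume (h '' E) = 0 := by
  have hsub : h '' E ⊆ g.Fix ∪ ⋃ J, η (e J) '' (θ J ⁻¹' E) := by
    rintro _ ⟨x, hx, rfl⟩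
    refine or_iff_not_imp_left.2 fun hgx => ?_
    obtain ⟨K, u, hKu⟩ := hη.exists_apply_eq hgx
    obtain ⟨J, rfl⟩ := e.surjective K
    obtain rfl : θ J u = x := h.injective ((hh J u).trans hKu)
    exact mem_iUnion.2 ⟨J, u, hx, (hh J u).symm⟩
  exact measure_mono_null hsub <| measure_union_null hg_null <| measure_iUnion_null fun J =>
    (hη (e J)).image_null _ ((hθ J).preimage_null _ hE)

theorem mem_HplusAC_of_apply_eq (hθ : f.IsLinearizationFamily θ) (hη : g.IsLinearizationFamily η)
    (hf_null : volume f.Fix = 0) (hg_null : volume g.Fix = 0)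
    (hh : ∀ J u, h (θ J u) = η (e J) u) : h ∈ HplusAC := by
  have hh_symm (K : g.OrderedOrbital) (u : ℝ) : h.symm (η K u) = θ (e.symm K) u := by
    rw [h.symm_apply_eq, hh, e.apply_symm_apply]
  exact mem_HplusAC_iff.2
    ⟨fun _ hE => hθ.volume_image_eq_zero_of_apply_eq hη hg_null hh hE,
      fun _ hE => hη.volume_image_eq_zero_of_apply_eq hθ hf_null hh_symm hE⟩

end IsLinearizationFamily

theorem exists_mul_eq_mul (hf : f ∈ HplusAC) (hg : g ∈ HplusAC) (hfC : f ∈ setC) (hgC : g ∈ setC)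
    (hf_null : volume f.Fix = 0) (hg_null : volume g.Fix = 0) :
    ∃ h ∈ HplusAC, h * f = g * h := by
  obtain ⟨e, he⟩ := OrderedOrbital.exists_orderIso hfC hgC
  obtain ⟨θ, hθ⟩ := exists_isLinearizationFamily hf
  obtain ⟨η, hη⟩ := exists_isLinearizationFamily hg
  obtain ⟨h, hh⟩ := hθ.exists_apply_eq_comp hη hf_null hg_null e
  have he_shift (J : f.OrderedOrbital) : (e J).shift = J.shift := by
    classical exact if_congr (iff_of_eq (he J)) rfl rfl
  exact ⟨h, hθ.mem_HplusAC_of_apply_eq hη hf_null hg_null hh,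
    hθ.mul_eq_mul_of_apply_eq hη hf_null he_shift hh⟩

theorem conj_apply_apply (f h : Hplus) (x : unitInterval) : (h * f * h⁻¹) (h x) = h (f x) :=
  congrArg (fun y => h (f y)) (h.symm_apply_apply x)

theorem Fix_conj (f h : Hplus) : (h * f * h⁻¹).Fix = h '' f.Fix := by
  ext z
  obtain ⟨x, rfl⟩ := h.surjective z
  rw [h.injective.mem_set_image, Fix, Fix, mem_ofPred_eq, mem_ofPred_eq, conj_apply_apply,
    h.injective.eq_iff]

theorem IsAlternating.conj (hf : f.IsAlternating) (h : Hplus) : (h * f * h⁻¹).IsAlternating := by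
  intro z hz U hU
  obtain ⟨z, rfl⟩ := h.surjective z
  rw [conj_apply_apply, h.injective.eq_iff] at hz
  obtain ⟨x₁, hx₁, x₂, hx₂, x₃, hx₃, h₁₂, h₂₃, hpos₁, hneg₂, hpos₃⟩ :=
    hf z hz _ (h.continuous.continuousAt.preimage_mem_nhds hU)
  refine ⟨h x₁, hx₁, h x₂, hx₂, h x₃, hx₃, h.strictMono h₁₂, h.strictMono h₂₃, ?_⟩
  simp only [conj_apply_apply, h.lt_iff_lt]
  exact ⟨hpos₁, hneg₂, hpos₃⟩

end Hplus

namespace HplusAC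

theorem conj_mem_setCN {f : HplusAC} (hf : f ∈ setCN) (h : HplusAC) : h * f * h⁻¹ ∈ setCN := by
  rw [setCN_eq] at hf ⊢
  refine ⟨hf.1.conj h.1, ?_⟩
  change volume (h.1 * f.1 * h.1⁻¹).Fix = 0
  rw [Hplus.Fix_conj]
  exact (Hplus.mem_HplusAC_iff.1 h.2).1 _ hf.2

theorem isConj_of_mem_setCN {f g : HplusAC} (hf : f ∈ setCN) (hg : g ∈ setCN) : IsConj f g := by
  obtain ⟨h, hh, hconj⟩ := Hplus.exists_mul_eq_mul f.2 g.2 hf.1 hg.1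
    (Hplus.volume_Fix_eq_zero_iff.2 hf.2) (Hplus.volume_Fix_eq_zero_iff.2 hg.2)
  exact isConj_iff.2 ⟨⟨h, hh⟩, mul_inv_eq_iff_eq_mul.2 (Subtype.ext hconj)⟩

theorem setCN_eq_conjugatesOf {f : HplusAC} (hf : f ∈ setCN) : setCN = conjugatesOf f := by
  refine Subset.antisymm (fun g hg => isConj_of_mem_setCN hf hg) fun g (hfg : IsConj f g) => ?_
  obtain ⟨h, rfl⟩ := isConj_iff.1 hfg
  exact conj_mem_setCN hf h

end HplusAC

theorem setOf_isGenericElement_eq_conjugatesOf {G : Type*} [Group G] [TopologicalSpace G]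
    [BaireSpace G] {g : G} (hg : IsGenericElement g) :
    {k : G | IsGenericElement k} = conjugatesOf g := by
  ext k
  refine ⟨fun hk => ?_, fun (hgk : IsConj g k) => ?_⟩
  · obtain ⟨x, hgx, hkx⟩ := (dense_of_mem_residual (inter_mem hg hk)).nonempty
    exact IsConj.trans hgx (IsConj.symm hkx)
  · rw [mem_ofPred_eq, IsGenericElement, ← hgk.conjugatesOf_eq]
    exact hg

theorem mainTheorem2 :
    -- generic elements exist
    (∃ f : HplusAC, IsGenericElement f) ∧
    -- the generic elements are exactly those with the properties (i), (ii), (iii)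
    (∀ f : HplusAC, IsGenericElement f ↔
      -- (i) the (nonempty, compact) fixed point set is a Cantor set
      (IsTotallyDisconnected f.1.Fix ∧ Preperfect f.1.Fix) ∧
      -- (ii) between any two components there are points of both parities
      (∀ a b c d : unitInterval, Ioo a b ∈ f.1.nonzeroOrbitals → Ioo c d ∈ f.1.nonzeroOrbitals →
        b < c → ∃ x ∈ Ioo b c, ∃ y ∈ Ioo b c, f.1 x < x ∧ y < f.1 y) ∧
      -- (iii) the fixed point set is Lebesgue-null
      volume ((fun x : unitInterval => (x : ℝ)) '' f.1.Fix) = 0) ∧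
    -- the generic elements form a single conjugacy class, and they are the set `C ∩ N ∩ H₊^{AC}`
    (∃ f : HplusAC, HplusAC.setCN = conjugatesOf f) ∧
    {f : HplusAC | IsGenericElement f} = HplusAC.setCN ∧
    -- which is a dense `G_δ` set
    IsGδ HplusAC.setCN ∧
    Dense HplusAC.setCN := by
  obtain ⟨f, hf⟩ := HplusAC.dense_setCN.nonempty
  have hconj : HplusAC.setCN = conjugatesOf f := HplusAC.setCN_eq_conjugatesOf hf
  have hgeneric : IsGenericElement f := by
    rw [IsGenericElement, ← hconj]
    exact residual_of_dense_Gδ HplusAC.isGδ_setCN HplusAC.dense_setCN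
  have hset : {g : HplusAC | IsGenericElement g} = HplusAC.setCN :=
    (setOf_isGenericElement_eq_conjugatesOf hgeneric).trans hconj.symm
  refine ⟨⟨f, hgeneric⟩, fun g => ?_, ⟨f, hconj⟩, hset, HplusAC.isGδ_setCN, HplusAC.dense_setCN⟩
  rw [← Hplus.mem_setC_inter_setN_iff_isTotallyDisconnected_Fix]
  exact Set.ext_iff.1 hset g
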